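/- Consider the degraded discrete-time Poisson wiretap channel with slot duration $\Delta>0$, channel gains $\alpha_B,\alpha_E>0$ and dark currents $\lambda_B,\lambda_E>0$: given an input intensity $X=x\ge 0$, the legitimate receiver's output $Y$ is Poisson distributed with mean $(\alpha_B x+\lambda_B)\Delta$ and the eavesdropper's output $Z$ is Poisson distributed with mean $(\alpha_E x+\lambda_E)\Delta$. Assume $\alpha_B\ge\alpha_E$ and $\lambda_B/\alpha_B\le\lambda_E/\alpha_E$, with at least one of the two inequalities strict. For $\mathcal A>0$ and $\mathcal E>0$ let $\Omega^+_{\mathcal A,\mathcal E}$ be the set of all probability distributions $F$ on $[0,\mathcal A]$ with $\int x\,dF(x)\le\mathcal E$. For an input $X\sim F$ let $I_B(F)=\frac1\Delta I(X;Y)$ and $I_E(F)=\frac1\Delta I(X;Z)$ be the mutual informations per unit of time. A pair $(R,R_e)$ is said to be achieved by $F$ if $0\le R\le I_B(F)$ and $0\le R_e\le I_B(F)-I_E(F)$; the rate-equivocation region $\mathcal R\subset\mathbb R^2$ is the set of all pairs achieved by some $F\in\Omega^+_{\mathcal A,\mathcal E}$. Its (outer) boundary consists of those points $(R,R_e)$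 of the topological boundary of $\mathcal R$ for which no $(R',R_e')\in\mathcal R$ satisfies both $R'>R$ and $R_e'>R_e$. Then $I_B(F)$ and $I_E(F)$ are finite for every $F\in\Omega^+_{\mathcal A,\mathcal E}$, and: (1) For every $\mu\in[0,1]$ the functional $f_\mu(F)=\mu I_B(F)+(1-\mu)\,[I_B(F)-I_E(F)]$ has a unique maximizer $F^*$ over $\Omega^+_{\mathcal A,\mathcal E}$. This maximizer is discrete with finitely many mass points, and the point $(I_B(F^*),\,I_B(F^*)-I_E(F^*))$ lies on the outer boundary of $\mathcal R$. (2) Every point of the outer boundary of $\mathcal R$ is achieved by exactly one $F\in\Omega^+_{\mathcal A,\mathcal E}$. This $F$ is discrete with finitely many mass points, and it maximizes $f_\mu$ over $\Omega^+_{\mathcal A,\mathcal E}$ for some $\mu\in[0,1]$. -/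

import Mathlib

open MeasureTheory ProbabilityTheory Set
open scoped ENNReal NNReal

noncomputable section

/-- The parameters of a discrete-time Poisson wiretap channel: the channel gains and the dark
currents of the legitimate receiver (`B`) and of the eavesdropper (`E`), and the slot length. -/
structure PoissonWiretap where
  gainB : ℝ
  gainE : ℝ
  darkB : ℝ
  darkE : ℝ
  slot : ℝ

/-- The standing assumptions: all parameters are positive (positivity of `gainB` follows from
`gain_le`), the channel is degraded, and the two receivers' channels do not coincide, i.e. at least
one of the two degradedness inequalities is strict. -/
structure PoissonWiretap.IsDegraded (W : PoissonWiretap) : Prop where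
  slot_pos : 0 < W.slot
  gainE_pos : 0 < W.gainE
  darkB_pos : 0 < W.darkB
  darkE_pos : 0 < W.darkE
  gain_le : W.gainE ≤ W.gainB
  dark_le : W.darkB / W.gainB ≤ W.darkE / W.gainE
  strict : W.gainE < W.gainB ∨ W.darkB / W.gainB < W.darkE / W.gainE

theorem measurable_poissonMeasure : Measurable (fun r : ℝ≥0 => poissonMeasure r) := by
  refine Measure.measurable_of_measurable_coe _ fun s hs => ?_
  simp only [poissonMeasure, Measure.sum_apply _ hs, Measure.smul_apply, smul_eq_mul]
  refine Measurable.ennreal_tsum fun n => ?_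
  exact Measurable.mul_const (by fun_prop) _

/-- The Poisson channel: given the input intensity `x`, the output is Poisson distributed with mean
`(gain * x + dark) * slot`. (The truncation `toNNReal` is inactive for `x ≥ 0`.) -/
def poissonChannel (gain dark slot : ℝ) : Kernel ℝ ℕ where
  toFun x := poissonMeasure ((gain * x + dark) * slot).toNNReal
  measurable' := measurable_poissonMeasure.comp (by fun_prop)

/-- Mutual information (in nats) between the input and the output of the channel `κ` when the input
has law `F`: the Kullback-Leibler divergence of the joint law from the product of its marginals. -/
def mutualInfo {α β : Type*} [MeasurableSpace α] [MeasurableSpace β]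
    (F : Measure α) (κ : Kernel α β) : ℝ≥0∞ :=
  InformationTheory.klDiv (F.compProd κ) (F.prod (F.bind κ))

/-- The inputs with peak-intensity constraint `A` and average-intensity constraint `E`: the laws
carried by `[0, A]` with mean at most `E`. -/
def feasibleInputs (A E : ℝ) : Set (ProbabilityMeasure ℝ) :=
  {F | (F : Measure ℝ) (Icc 0 A) = 1 ∧ ∫ x in Icc 0 A, x ∂(F : Measure ℝ) ≤ E}

/-- A law is discrete with finitely many mass points if some finite set carries all its mass. -/
def IsFinitelyDiscrete (F : ProbabilityMeasure ℝ) : Prop :=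
  ∃ S : Finset ℝ, (F : Measure ℝ) ((S : Set ℝ)ᶜ) = 0

namespace PoissonWiretap

variable (W : PoissonWiretap)

/-- The channel from the transmitter to the legitimate receiver. -/
def channelB : Kernel ℝ ℕ := poissonChannel W.gainB W.darkB W.slot

/-- The channel from the transmitter to the eavesdropper. -/
def channelE : Kernel ℝ ℕ := poissonChannel W.gainE W.darkE W.slot

/-- `I(X;Y)` per unit of time, for an input of law `F`. -/
def infoB (F : ProbabilityMeasure ℝ) : ℝ :=
  1 / W.slot * (mutualInfo (F : Measure ℝ) W.channelB).toReal

/-- `I(X;Z)` per unit of time, for an input of law `F`. -/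
def infoE (F : ProbabilityMeasure ℝ) : ℝ :=
  1 / W.slot * (mutualInfo (F : Measure ℝ) W.channelE).toReal

/-- The objective `μ I(X;Y) + (1 - μ) [I(X;Y) - I(X;Z)]`. -/
def objective (μ : ℝ) (F : ProbabilityMeasure ℝ) : ℝ :=
  μ * W.infoB F + (1 - μ) * (W.infoB F - W.infoE F)

/-- The input law `F` achieves the rate-equivocation pair `p = (R, Rₑ)`. -/
def Achieves (F : ProbabilityMeasure ℝ) (p : ℝ × ℝ) : Prop :=
  (0 ≤ p.1 ∧ p.1 ≤ W.infoB F) ∧ (0 ≤ p.2 ∧ p.2 ≤ W.infoB F - W.infoE F)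

/-- The rate-equivocation region under peak- and average-intensity constraints. -/
def region (A E : ℝ) : Set (ℝ × ℝ) :=
  {p | ∃ F ∈ feasibleInputs A E, W.Achieves F p}

/-- The boundary of the rate-equivocation region: the topological boundary points at which rate and
equivocation cannot both be increased. (For this region it leaves out exactly the boundary points
that lie on a coordinate axis for the sole reason that rates and equivocations are nonnegative.) -/
def boundary (A E : ℝ) : Set (ℝ × ℝ) :=
  {p | p ∈ frontier (W.region A E) ∧ ∀ q ∈ W.region A E, ¬ (p.1 < q.1 ∧ p.2 < q.2)}

end PoissonWiretap

end

/-! Put ν = 1 - μ. Up to the factor 1/Δ the objective is I(X;Y) - ν I(X;Z). Let `crossGain ν F G` be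
the difference of the two information densities of F, averaged over G: it is affine in G, and its
diagonal is the objective. Averaging the density of F over G gives the mutual information of G plus
the divergence of the output law of G from that of F (`crossInfo_eq_add_discreteKL`). So `crossGain
ν F G` exceeds `crossGain ν G G` by D_B - ν D_E, where D_B and D_E are these divergences at the two
receivers. The eavesdropper sees the legitimate output after thinning and independent Poisson noise,
so 0 ≤ D_E ≤ D_B by data processing. Since the degradation is strict, D_E = D_B forces equal output
laws at the legitimate receiver, and those determine the input law. Hence `crossGain_le`: the
diagonal value at G is at most `crossGain ν F G`, strictly below unless F = G.

This one inequality gives concavity, uniqueness of maximizers (through the midpoint), the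
first-order condition (through mixtures of vanishing weight) and, with point masses for G,
nonnegativity of the secrecy rate. Maximizers exist because the feasible set is weakly compact and
`crossGain` is continuous.

For discreteness, the first-order condition and a Lagrange multiplier for the mean constraint bound
the density difference of a maximizer by an affine function, with equality almost everywhere. In the
variable t, the mean output of the legitimate receiver, the difference is real analytic on (0, ∞).
Were the equality set infinite in the physical range, equality would hold down to t = 0, where an
uncancelled t log t term contradicts differentiability (`finite_setOf_density_eq_affine`).

The region is compact and convex. A boundary point therefore belongs to it and, being undominated,
maximizes some weighting μ R + (1 - μ) Rₑ over it. Every law achieving the point then maximizes f_μ,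
and uniqueness and discreteness carry over. -/

section Gibbs

/-! ### Gibbs' inequality -/

variable {α : Type*} [MeasurableSpace α]

/-- Gibbs' inequality: a positive function with integral at most `1` has nonpositive mean
logarithm. -/
theorem integral_log_nonpos_of_lintegral_le_one {μ : Measure α} [IsProbabilityMeasure μ] {f : α → ℝ}
    (hpos : ∀ᵐ x ∂μ, 0 < f x) (hf : AEStronglyMeasurable f μ)
    (hint : ∫⁻ x, ENNReal.ofReal (f x) ∂μ ≤ 1) (hlog : Integrable (fun x => Real.log (f x)) μ) :
    ∫ x, Real.log (f x) ∂μ ≤ 0 ∧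
      (∫ x, Real.log (f x) ∂μ = 0 → ∀ᵐ x ∂μ, f x = 1) := by
  have hfi : Integrable f μ := by
    refine ⟨hf, ?_⟩
    rw [hasFiniteIntegral_iff_ofReal (hpos.mono fun x hx => hx.le)]
    exact hint.trans_lt ENNReal.one_lt_top
  have hle : ∫ x, f x ∂μ ≤ 1 := by
    rw [integral_eq_lintegral_of_nonneg_ae (hpos.mono fun x hx => hx.le) hf]
    exact ENNReal.toReal_le_of_le_ofReal zero_le_one (by simpa using hint)
  have hdi : Integrable (fun x => f x - 1 - Real.log (f x)) μ :=
    (hfi.sub (integrable_const 1)).sub hlog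
  -- The tangent bound log t ≤ t - 1 is strict off t = 1, so a vanishing mean logarithm forces f =
  -- 1.
  have hd0 : 0 ≤ᵐ[μ] fun x => f x - 1 - Real.log (f x) := by
    filter_upwards [hpos] with x hx
    have := Real.log_le_sub_one_of_pos hx
    simp only [Pi.zero_apply]; linarith
  have heq : ∫ x, (f x - 1 - Real.log (f x)) ∂μ = ∫ x, f x ∂μ - 1 - ∫ x, Real.log (f x) ∂μ := by
    have h1 : Integrable (fun x => f x - 1) μ := hfi.sub (integrable_const 1)
    rw [integral_sub h1 hlog, integral_sub hfi (integrable_const 1)]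
    simp
  have hd := integral_nonneg_of_ae hd0
  refine ⟨by linarith, fun h0 => ?_⟩
  have hz : ∫ x, (f x - 1 - Real.log (f x)) ∂μ = 0 := le_antisymm (by linarith) hd
  rw [integral_eq_zero_iff_of_nonneg_ae hd0 hdi] at hz
  filter_upwards [hz, hpos] with x hx hxp
  by_contra hne
  have := Real.log_lt_sub_one_of_pos hxp hne
  simp only [Pi.zero_apply] at hx
  linarith

end Gibbs

/-! ### Divergence on ℕ and data processing -/

section Discrete

/-- Kullback-Leibler divergence of laws on `ℕ` with full support, as an integral. -/
noncomputable def discreteKL (P Q : Measure ℕ) : ℝ :=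
  ∫ y, Real.log (P.real {y} / Q.real {y}) ∂P

/-- Change of measure: P has full support, so the ratio of point masses is the density of Q with
respect to P. -/
theorem lintegral_mul_ratio {P Q : Measure ℕ} [IsFiniteMeasure P] [IsFiniteMeasure Q]
    (hP : ∀ y, 0 < P.real {y}) (φ : ℕ → ℝ≥0∞) :
    ∫⁻ y, ENNReal.ofReal (Q.real {y} / P.real {y}) * φ y ∂P = ∫⁻ y, φ y ∂Q := by
  rw [lintegral_countable', lintegral_countable']
  refine tsum_congr fun y => ?_
  have h1 : P {y} = ENNReal.ofReal (P.real {y}) := by simp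
  have h2 : Q {y} = ENNReal.ofReal (Q.real {y}) := by simp
  rw [h1, h2, mul_right_comm, ← ENNReal.ofReal_mul (by positivity), div_mul_cancel₀ _ (hP y).ne',
    mul_comm]

theorem discreteKL_nonneg {P Q : Measure ℕ} [IsProbabilityMeasure P] [IsProbabilityMeasure Q]
    (hP : ∀ y, 0 < P.real {y}) (hQ : ∀ y, 0 < Q.real {y})
    (hint : Integrable (fun y => Real.log (P.real {y} / Q.real {y})) P) : 0 ≤ discreteKL P Q := by
  have h := (integral_log_nonpos_of_lintegral_le_one (μ := P)
    (f := fun y => Q.real {y} / P.real {y}) (.of_forall fun y => div_pos (hQ y) (hP y))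
    AEStronglyMeasurable.of_discrete
    (by simpa using (lintegral_mul_ratio (Q := Q) hP (fun _ => 1)).le)
    (by
      refine hint.neg.congr (.of_forall fun y => ?_)
      simp only [Pi.neg_apply]
      rw [← Real.log_inv, inv_div])).1
  have h2 : discreteKL P Q = - ∫ y, Real.log (Q.real {y} / P.real {y}) ∂P := by
    rw [discreteKL, ← integral_neg]
    refine integral_congr_ae (.of_forall fun y => ?_)
    simp only
    rw [← Real.log_inv, inv_div]
  linarith

/-- Data processing for the Kullback-Leibler divergence on `ℕ`, with its case of equality for a
kernel any two of whose rows overlap. -/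
theorem discreteKL_bind_le {P Q : Measure ℕ} [IsProbabilityMeasure P] [IsProbabilityMeasure Q]
    (W : Kernel ℕ ℕ) [IsMarkovKernel W]
    (hW : ∀ y₁ y₂, ∃ z, 0 < (W y₁).real {z} ∧ 0 < (W y₂).real {z})
    (hP : ∀ y, 0 < P.real {y}) (hQ : ∀ y, 0 < Q.real {y})
    (hP' : ∀ z, 0 < (P.bind W).real {z}) (hQ' : ∀ z, 0 < (Q.bind W).real {z})
    (hint : Integrable (fun y => Real.log (P.real {y} / Q.real {y})) P)
    (hint' : Integrable (fun z => Real.log ((P.bind W).real {z} / (Q.bind W).real {z}))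
      (P.bind W)) :
    discreteKL (P.bind W) (Q.bind W) ≤ discreteKL P Q ∧
      (discreteKL (P.bind W) (Q.bind W) = discreteKL P Q → P = Q) := by
  set P' := P.bind W
  set Q' := Q.bind W
  -- Under the joint law of input and output of `W` started from P, this function has integral 1,
  -- and its logarithm has mean D(P'‖Q') - D(P‖Q). Gibbs' inequality applies to it, equality case
  -- included.
  let f : ℕ × ℕ → ℝ := fun p =>
    (P'.real {p.2} / Q'.real {p.2}) * (Q.real {p.1} / P.real {p.1})
  have hfpos : ∀ p, 0 < f p := fun p => by
    have := hP p.1; have := hQ p.1; have := hP' p.2; have := hQ' p.2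
    positivity
  have hlogf : ∀ p, Real.log (f p) = Real.log (P'.real {p.2} / Q'.real {p.2})
      - Real.log (P.real {p.1} / Q.real {p.1}) := fun p => by
    rw [Real.log_mul (div_pos (hP' _) (hQ' _)).ne' (div_pos (hQ _) (hP _)).ne', sub_eq_add_neg,
      ← Real.log_inv, inv_div]
  have hfst : (P.compProd W).map Prod.fst = P := Measure.fst_compProd P W
  have hsnd : (P.compProd W).map Prod.snd = P' := Measure.snd_compProd P W
  have hmapfst : ∀ g : ℕ → ℝ, ∫ p, g p.1 ∂(P.compProd W) = ∫ y, g y ∂P := fun g => by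
    conv_rhs => rw [← hfst]
    rw [integral_map measurable_fst.aemeasurable AEStronglyMeasurable.of_discrete]
  have hmapsnd : ∀ g : ℕ → ℝ, ∫ p, g p.2 ∂(P.compProd W) = ∫ y, g y ∂P' := fun g => by
    conv_rhs => rw [← hsnd]
    rw [integral_map measurable_snd.aemeasurable AEStronglyMeasurable.of_discrete]
  have hi1 : Integrable (fun p : ℕ × ℕ => Real.log (P.real {p.1} / Q.real {p.1}))
      (P.compProd W) :=
    Integrable.comp_measurable (f := Prod.fst)
      (g := fun y => Real.log (P.real {y} / Q.real {y})) (by rw [hfst]; exact hint) measurable_fst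
  have hi2 : Integrable (fun p : ℕ × ℕ => Real.log (P'.real {p.2} / Q'.real {p.2}))
      (P.compProd W) :=
    Integrable.comp_measurable (f := Prod.snd)
      (g := fun y => Real.log (P'.real {y} / Q'.real {y})) (by rw [hsnd]; exact hint')
      measurable_snd
  have hE1 : ∫ p, Real.log (P.real {p.1} / Q.real {p.1}) ∂(P.compProd W) = discreteKL P Q :=
    hmapfst fun y => Real.log (P.real {y} / Q.real {y})
  have hE2 : ∫ p, Real.log (P'.real {p.2} / Q'.real {p.2}) ∂(P.compProd W) = discreteKL P' Q' :=
    hmapsnd fun y => Real.log (P'.real {y} / Q'.real {y})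
  have hlint : ∫⁻ p, ENNReal.ofReal (f p) ∂(P.compProd W) = 1 := by
    rw [Measure.lintegral_compProd (by fun_prop)]
    have : ∀ y z, ENNReal.ofReal (f (y, z)) = ENNReal.ofReal (Q.real {y} / P.real {y}) *
        ENNReal.ofReal (P'.real {z} / Q'.real {z}) := fun y z => by
      rw [← ENNReal.ofReal_mul (by positivity), mul_comm]
    simp_rw [this]
    simp_rw [lintegral_const_mul' _ _ ENNReal.ofReal_ne_top]
    rw [lintegral_mul_ratio hP,
      ← Measure.lintegral_bind (m := Q) (μ := W) (f := fun z => ENNReal.ofReal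
        (P'.real {z} / Q'.real {z})) W.measurable.aemeasurable (by fun_prop)]
    simpa using lintegral_mul_ratio (Q := P') hQ' (fun _ => 1)
  obtain ⟨h1, h2⟩ := integral_log_nonpos_of_lintegral_le_one (μ := P.compProd W) (f := f)
    (.of_forall hfpos) AEStronglyMeasurable.of_discrete hlint.le
    (by simp_rw [hlogf]; exact hi2.sub hi1)
  have hE : ∫ p, Real.log (f p) ∂(P.compProd W) = discreteKL P' Q' - discreteKL P Q := by
    simp_rw [hlogf]
    rw [integral_sub hi2 hi1, hE1, hE2]
  rw [hE] at h1 h2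
  refine ⟨by linarith, fun heq => ?_⟩
  have hae := h2 (by linarith)
  have hpt : ∀ y z, 0 < (W y).real {z} → f (y, z) = 1 := by
    intro y z hyz
    by_contra hne
    have h0 : (P.compProd W) {(y, z)} = 0 := measure_mono_null (by simpa using hne) hae
    rw [← Set.singleton_prod_singleton, Measure.compProd_apply_prod (by simp) (by simp),
      lintegral_singleton] at h0
    rcases mul_eq_zero.1 h0 with h | h
    · simp [measureReal_def, h] at hyz
    · have := hP y
      simp [measureReal_def, h] at this
  -- Evaluating f = 1 at an output z reachable from both y and 0 eliminates the factor depending on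
  -- z.
  have hconst : ∀ y, Q.real {y} = (Q.real {0} / P.real {0}) * P.real {y} := by
    intro y
    obtain ⟨z, hz1, hz2⟩ := hW y 0
    have e1 := hpt y z hz1
    have e2 := hpt 0 z hz2
    have hr := div_pos (hP' z) (hQ' z)
    have : Q.real {y} / P.real {y} = Q.real {0} / P.real {0} := by
      refine mul_left_cancel₀ hr.ne' ?_
      exact e1.trans e2.symm
    rw [← this, div_mul_cancel₀ _ (hP y).ne']
  have hone : Q.real {0} / P.real {0} = 1 := by
    set c := Q.real {0} / P.real {0}
    have hc : Q = ENNReal.ofReal c • P := by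
      refine Measure.ext_of_singleton fun y => ?_
      have h1 : P {y} = ENNReal.ofReal (P.real {y}) := by simp
      have h2 : Q {y} = ENNReal.ofReal (Q.real {y}) := by simp
      rw [Measure.smul_apply, smul_eq_mul, h1, h2, ← ENNReal.ofReal_mul
        (div_pos (hQ 0) (hP 0)).le, hconst y]
    have := congrArg (fun μ : Measure ℕ => μ univ) hc
    simp only [Measure.smul_apply, measure_univ, smul_eq_mul, mul_one] at this
    exact (ENNReal.ofReal_eq_one.1 this.symm)
  refine Measure.ext_of_measureReal_singleton fun y => ?_
  rw [hconst y, hone, one_mul]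

end Discrete

/-! ### Thinning of Poisson counts -/

section Thinning

open unitInterval
open scoped Nat

/-- Only n ≥ k contributes to the mass at k; with n = i + k the remaining sum over i is the
exponential series of (1 - θ) b. -/
theorem poissonMeasure_bind_binomial (b : ℝ≥0) (θ : I) :
    (poissonMeasure b).bind (fun n => binomial n θ) =
      poissonMeasure (Real.toNNReal θ * b) := by
  refine Measure.ext_of_singleton fun k => ?_
  rw [Measure.bind_apply (by simp) (Measurable.of_discrete).aemeasurable, lintegral_countable']
  simp_rw [binomial_singleton, poissonMeasure_singleton]
  have hb : (0 : ℝ) ≤ b := b.2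
  have hθ : (0 : ℝ) ≤ θ := θ.2.1
  have hθ' : (0 : ℝ) ≤ 1 - θ := by linarith [θ.2.2]
  have key : HasSum (fun n : ℕ => ((n.choose k : ℝ) * (θ : ℝ) ^ k * (1 - (θ : ℝ)) ^ (n - k)) *
      (Real.exp (-b) * b ^ n / n !))
      (Real.exp (-(θ * b : ℝ)) * (θ * b : ℝ) ^ k / k !) := by
    have h1 := (NormedSpace.expSeries_div_hasSum_exp ((1 - θ) * (b : ℝ))).mul_left
      (Real.exp (-b) * (θ * b : ℝ) ^ k / k !)
    rw [← Real.exp_eq_exp_ℝ] at h1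
    have hval : Real.exp (-b) * (θ * b : ℝ) ^ k / k ! * Real.exp ((1 - θ) * (b : ℝ)) =
        Real.exp (-(θ * b : ℝ)) * (θ * b : ℝ) ^ k / k ! := by
      have : Real.exp (-(θ * b : ℝ)) = Real.exp (-b) * Real.exp ((1 - θ) * (b : ℝ)) := by
        rw [← Real.exp_add]; congr 1; ring
      rw [this]; ring
    rw [hval] at h1
    have h2 : (fun i : ℕ => Real.exp (-b) * (θ * b : ℝ) ^ k / k ! *
        (((1 - θ) * (b : ℝ)) ^ i / i !)) = fun i : ℕ =>
        (((i + k).choose k : ℝ) * (θ : ℝ) ^ k * (1 - (θ : ℝ)) ^ (i + k - k)) *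
          (Real.exp (-b) * b ^ (i + k) / (i + k) !) := by
      funext i
      have hch : ((i + k).choose k : ℝ) = (i + k) ! / (i ! * k !) := by
        rw [add_comm i k, Nat.cast_add_choose, mul_comm]
      rw [hch, Nat.add_sub_cancel, mul_pow (1 - (θ : ℝ))]
      have := Nat.factorial_pos i; have := Nat.factorial_pos k
      have := Nat.factorial_pos (i + k)
      field_simp
      ring
    rw [h2] at h1
    refine (hasSum_nat_add_iff' (f := fun n : ℕ => ((n.choose k : ℝ) * (θ : ℝ) ^ k *
      (1 - (θ : ℝ)) ^ (n - k)) * (Real.exp (-b) * b ^ n / n !)) k).1 ?_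
    rw [Finset.sum_eq_zero, sub_zero]
    · exact h1
    · intro i hi
      rw [Nat.choose_eq_zero_of_lt (Finset.mem_range.1 hi)]
      simp
  have hnn : ∀ n : ℕ, 0 ≤ ((n.choose k : ℝ) * (θ : ℝ) ^ k * (1 - (θ : ℝ)) ^ (n - k)) *
      (Real.exp (-b) * b ^ n / n !) := fun n => by positivity
  have hterm : ∀ n : ℕ, ENNReal.ofReal ((n.choose k : ℝ) * (θ : ℝ) ^ k *
      (1 - (θ : ℝ)) ^ (n - k)) * ENNReal.ofReal (Real.exp (-b) * b ^ n / n !) =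
      ENNReal.ofReal (((n.choose k : ℝ) * (θ : ℝ) ^ k * (1 - (θ : ℝ)) ^ (n - k)) *
      (Real.exp (-b) * b ^ n / n !)) := fun n => (ENNReal.ofReal_mul (by positivity)).symm
  simp_rw [hterm]
  rw [← ENNReal.ofReal_tsum_of_nonneg hnn key.summable, key.tsum_eq]
  simp [NNReal.coe_mul, Real.coe_toNNReal _ hθ]

/-- Thinning with retention probability `θ`, followed by independent Poisson noise of mean `c`. -/
noncomputable def thinningKernel (θ : I) (c : ℝ≥0) : Kernel ℕ ℕ :=
  Kernel.ofFunOfCountable fun n => Measure.conv (binomial n θ) (poissonMeasure c)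

theorem thinningKernel_apply (θ : I) (c : ℝ≥0) (n : ℕ) :
    thinningKernel θ c n = Measure.conv (binomial n θ) (poissonMeasure c) := rfl

instance (θ : I) (c : ℝ≥0) : IsMarkovKernel (thinningKernel θ c) :=
  ⟨fun n => by rw [thinningKernel_apply]; infer_instance⟩

theorem poissonMeasure_bind_thinningKernel (b : ℝ≥0) (θ : I) (c : ℝ≥0) :
    (poissonMeasure b).bind (thinningKernel θ c) =
      poissonMeasure (Real.toNNReal θ * b + c) := by
  rw [← poissonMeasure_conv_poissonMeasure, ← poissonMeasure_bind_binomial]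
  ext s hs
  rw [Measure.bind_apply hs (Kernel.measurable _).aemeasurable, ← lintegral_indicator_one hs,
    Measure.lintegral_conv (measurable_one.indicator hs),
    Measure.lintegral_bind (Measurable.of_discrete).aemeasurable
      (Measurable.of_discrete).aemeasurable]
  refine lintegral_congr fun n => ?_
  rw [thinningKernel_apply, ← lintegral_indicator_one hs,
    Measure.lintegral_conv (measurable_one.indicator hs)]

/-- If θ < 1, every row can lose all its counts and charges 0. If c > 0, row n can keep all its
counts and add noise, so it charges every m ≥ n. Strictness of the degradation enters data
processing here. -/
theorem thinningKernel_overlap {θ : I} {c : ℝ≥0} (hθ : 0 < (θ : ℝ)) (h : (θ : ℝ) < 1 ∨ 0 < c)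
    (y₁ y₂ : ℕ) : ∃ z, 0 < (thinningKernel θ c y₁).real {z} ∧
      0 < (thinningKernel θ c y₂).real {z} := by
  have hlow : ∀ n k j : ℕ, (binomial n θ).real {k} * (poissonMeasure c).real {j} ≤
      (thinningKernel θ c n).real {k + j} := by
    intro n k j
    rw [thinningKernel_apply, Measure.conv, map_measureReal_apply (by fun_prop) (by simp),
      ← measureReal_prod_prod]
    refine measureReal_mono ?_
    rintro ⟨a, b⟩ ⟨ha, hb⟩
    simp only [mem_singleton_iff] at ha hb
    simp [ha, hb]
  rcases h with h | h
  · have hpos : ∀ n, 0 < (thinningKernel θ c n).real {0 + 0} := fun n => by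
      refine lt_of_lt_of_le ?_ (hlow n 0 0)
      rw [binomial_real_zero, poissonMeasure_real_singleton]
      have : (0 : ℝ) < 1 - θ := by linarith
      have h1 : 0 < (1 - (θ : ℝ)) ^ n := by positivity
      have h2 := Real.exp_pos (-c)
      simpa using mul_pos h1 h2
    exact ⟨0, hpos _, hpos _⟩
  · have hpos : ∀ n m, n ≤ m → 0 < (thinningKernel θ c n).real {m} := fun n m hnm => by
      have := hlow n n (m - n)
      rw [Nat.add_sub_cancel' hnm] at this
      refine lt_of_lt_of_le ?_ this
      rw [binomial_real_self]
      exact mul_pos (by positivity) (poissonMeasure_real_singleton_pos _ h)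
    exact ⟨max y₁ y₂, hpos _ _ (le_max_left _ _), hpos _ _ (le_max_right _ _)⟩

end Thinning

/-! ### Poisson integrals of exponentially bounded functions -/

section PoissonIntegrals

open scoped Nat

variable {G : Type*} [NormedAddCommGroup G]

theorem hasSum_poissonMeasure_mul_pow (r : ℝ≥0) (B : ℝ) :
    HasSum (fun n : ℕ => Real.exp (-r) * r ^ n / n ! * B ^ n) (Real.exp ((B - 1) * r)) := by
  have h := (NormedSpace.expSeries_div_hasSum_exp (B * (r : ℝ))).mul_left (Real.exp (-r))
  rw [← Real.exp_eq_exp_ℝ, ← Real.exp_add] at h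
  convert! h using 1
  · funext n; rw [mul_pow]; ring
  · congr 1; ring

theorem integrable_poissonMeasure_of_le_pow {c : ℕ → G} {K B : ℝ} (hc : ∀ y, ‖c y‖ ≤ K * B ^ y)
    (r : ℝ≥0) : Integrable c (poissonMeasure r) := by
  rw [integrable_poissonMeasure_iff]
  refine Summable.of_nonneg_of_le (fun n => by positivity) (fun n => ?_)
    ((hasSum_poissonMeasure_mul_pow r B).summable.mul_left K)
  calc _ ≤ Real.exp (-r) * r ^ n / n ! * (K * B ^ n) := by gcongr; exact hc n
    _ = _ := by ring

theorem integral_norm_poissonMeasure_le {c : ℕ → G} {K B : ℝ} (hc : ∀ y, ‖c y‖ ≤ K * B ^ y)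
    (r : ℝ≥0) : ∫ y, ‖c y‖ ∂(poissonMeasure r) ≤ K * Real.exp ((B - 1) * r) := by
  have hint : Integrable (fun y : ℕ => K * B ^ y) (poissonMeasure r) := by
    rw [integrable_poissonMeasure_iff]
    refine ((hasSum_poissonMeasure_mul_pow r |B|).summable.mul_left |K|).congr fun n => ?_
    rw [Real.norm_eq_abs, abs_mul, abs_pow]
    ring
  refine (integral_mono (integrable_poissonMeasure_of_le_pow hc r).norm hint hc).trans_eq ?_
  rw [integral_poissonMeasure, ← (hasSum_poissonMeasure_mul_pow r B).tsum_eq, ← tsum_mul_left]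
  refine tsum_congr fun n => ?_
  rw [smul_eq_mul]; ring

theorem integral_id_poissonMeasure (r : ℝ≥0) : ∫ y, (y : ℝ) ∂(poissonMeasure r) = r := by
  rw [integral_poissonMeasure]
  have h := (hasSum_one_poissonMeasure r).mul_left (r : ℝ)
  rw [mul_one] at h
  refine HasSum.tsum_eq ((hasSum_nat_add_iff' (f := fun n : ℕ =>
    (Real.exp (-r) * r ^ n / n !) • (n : ℝ)) 1).1 ?_)
  simp only [Finset.range_one, Finset.sum_singleton, CharP.cast_eq_zero, smul_zero, sub_zero]
  convert! h using 1
  funext n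
  rw [Nat.factorial_succ, smul_eq_mul]
  push_cast
  have := Nat.factorial_pos n
  field_simp
  ring

theorem natCast_add_one_le_two_pow (y : ℕ) : (y : ℝ) + 1 ≤ 2 ^ y := by
  exact_mod_cast Nat.lt_two_pow_self (n := y)

theorem integral_bind_kernel {α β : Type*} [MeasurableSpace α] [MeasurableSpace β]
    [NormedSpace ℝ G] {μ : Measure α} {κ : Kernel α β} {f : β → G}
    (hf : Integrable f (μ.bind κ)) : ∫ y, f y ∂(μ.bind κ) = ∫ x, ∫ y, f y ∂(κ x) ∂μ := by
  rw [Measure.comp_eq_comp_const_apply] at hf ⊢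
  rw [Kernel.integral_comp hf, Kernel.const_apply]

end PoissonIntegrals

/-! ### The Poisson channel and its output moments -/

section Channel

open scoped Nat

/-- The mean of the output of the Poisson channel. -/
noncomputable def poissonRate (g d s x : ℝ) : ℝ≥0 := ((g * x + d) * s).toNNReal

variable {g d s A : ℝ}

/-- Positivity of the gain, the dark current and the slot length of a Poisson channel. -/
structure PoissonParams (g d s : ℝ) : Prop where
  gain_pos : 0 < g
  dark_pos : 0 < d
  slot_pos : 0 < s

theorem poissonChannel_apply (x : ℝ) :
    poissonChannel g d s x = poissonMeasure (poissonRate g d s x) := rfl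

instance : IsMarkovKernel (poissonChannel g d s) :=
  ⟨fun x => by rw [poissonChannel_apply]; infer_instance⟩

theorem continuous_poissonRate : Continuous (poissonRate g d s) := by
  unfold poissonRate; fun_prop

theorem coe_poissonRate (hp : PoissonParams g d s) {x : ℝ} (hx : 0 ≤ x) :
    (poissonRate g d s x : ℝ) = (g * x + d) * s :=
  Real.coe_toNNReal _ (by
    have := hp.gain_pos; have := hp.dark_pos; have := hp.slot_pos
    positivity)

theorem poissonRate_mem (hp : PoissonParams g d s) {x : ℝ} (hx : x ∈ Icc 0 A) :
    (poissonRate g d s x : ℝ) ∈ Icc (d * s) ((g * A + d) * s) := by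
  obtain ⟨hg, hd, hs⟩ := hp
  rw [coe_poissonRate ⟨hg, hd, hs⟩ hx.1]
  have := hx.1; have := hx.2
  constructor
  · nlinarith [mul_nonneg (mul_nonneg hg.le hx.1) hs.le]
  · gcongr

/-- The law of the channel output, without its factorial denominators: `y!` times the probability
of the output `y` when the input has law `F`. -/
noncomputable def outputMoment (g d s : ℝ) (F : Measure ℝ) (y : ℕ) : ℝ :=
  y ! * (F.bind (poissonChannel g d s)).real {y}

theorem bind_real_singleton (F : Measure ℝ) (y : ℕ) :
    (F.bind (poissonChannel g d s)).real {y} = outputMoment g d s F y / y ! := by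
  rw [outputMoment, mul_div_cancel_left₀]
  exact_mod_cast Nat.factorial_ne_zero y

theorem outputMoment_eq_integral (F : Measure ℝ) (y : ℕ) :
    outputMoment g d s F y = ∫ x, Real.exp (-(poissonRate g d s x : ℝ)) *
      (poissonRate g d s x : ℝ) ^ y ∂F := by
  have hc := continuous_poissonRate (g := g) (d := d) (s := s)
  rw [outputMoment, measureReal_def, Measure.bind_apply (by simp) (Kernel.aemeasurable _),
    integral_eq_lintegral_of_nonneg_ae (.of_forall fun x => by positivity)
      (by fun_prop)]
  have : ∀ x, ENNReal.ofReal (Real.exp (-(poissonRate g d s x : ℝ)) *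
      (poissonRate g d s x : ℝ) ^ y) = ENNReal.ofReal (y ! : ℝ) * poissonChannel g d s x {y} := by
    intro x
    rw [poissonChannel_apply, poissonMeasure_singleton, ← ENNReal.ofReal_mul (by positivity)]
    congr 1
    have := Nat.factorial_pos y
    field_simp
  simp_rw [this]
  rw [lintegral_const_mul' _ _ ENNReal.ofReal_ne_top, ENNReal.toReal_mul,
    ENNReal.toReal_ofReal (by positivity)]

/-! ### Bounds on output moments and integrability of their logarithms -/

section Bounds

variable {F : Measure ℝ} [IsProbabilityMeasure F]

theorem integrable_of_continuousOn (hF : ∀ᵐ x ∂F, x ∈ Icc 0 A)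
    {f : ℝ → ℝ} (hf : ContinuousOn f (Icc 0 A)) :
    Integrable f F := by
  have h : F.restrict (Icc 0 A) = F := Measure.restrict_eq_self_of_ae_mem hF
  rw [← h]
  exact hf.integrableOn_compact isCompact_Icc

/-- Without the factorial the moments lie between geometric sequences, uniformly in F, so their
logarithms grow at most linearly in y. The lower bound needs a positive dark current. -/
theorem outputMoment_mem (hp : PoissonParams g d s) (hF : ∀ᵐ x ∂F, x ∈ Icc 0 A) (y : ℕ) :
    outputMoment g d s F y ∈ Icc (Real.exp (-((g * A + d) * s)) * (d * s) ^ y) (((g * A + d) * s) ^ y) := by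
  have hc := continuous_poissonRate (g := g) (d := d) (s := s)
  rw [outputMoment_eq_integral]
  have hi : Integrable (fun x => Real.exp (-(poissonRate g d s x : ℝ)) *
      (poissonRate g d s x : ℝ) ^ y) F := by
    refine integrable_of_continuousOn hF ?_
    fun_prop
  constructor
  · have : ∫ x, Real.exp (-((g * A + d) * s)) * (d * s) ^ y ∂F =
        Real.exp (-((g * A + d) * s)) * (d * s) ^ y := by simp
    rw [← this]
    refine integral_mono_ae (integrable_const _) hi ?_
    filter_upwards [hF] with x hx
    obtain ⟨h1, h2⟩ := poissonRate_mem hp hx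
    have : 0 < d * s := mul_pos hp.dark_pos hp.slot_pos
    gcongr
  · have : ∫ x, ((g * A + d) * s) ^ y ∂F = ((g * A + d) * s) ^ y := by simp
    rw [← this]
    refine integral_mono_ae hi (integrable_const _) ?_
    filter_upwards [hF] with x hx
    obtain ⟨h1, h2⟩ := poissonRate_mem hp hx
    have h3 : Real.exp (-(poissonRate g d s x : ℝ)) ≤ 1 := by
      rw [Real.exp_le_one_iff]; simp
    calc _ ≤ 1 * (poissonRate g d s x : ℝ) ^ y := by gcongr
      _ ≤ _ := by rw [one_mul]; gcongr

theorem outputMoment_pos (hp : PoissonParams g d s) (hF : ∀ᵐ x ∂F, x ∈ Icc 0 A) (y : ℕ) :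
    0 < outputMoment g d s F y :=
  lt_of_lt_of_le (mul_pos (Real.exp_pos _) (pow_pos (mul_pos hp.dark_pos hp.slot_pos) _))
    (outputMoment_mem hp hF y).1

theorem bind_real_singleton_pos (hp : PoissonParams g d s) (hF : ∀ᵐ x ∂F, x ∈ Icc 0 A) (y : ℕ) :
    0 < (F.bind (poissonChannel g d s)).real {y} := by
  rw [bind_real_singleton]
  have := outputMoment_pos hp hF y
  positivity

theorem log_bound_of_mem {a b M : ℝ} (ha : 0 < a) (hb : 0 < b) {y : ℕ}
    (hM : M ∈ Icc (Real.exp (-b) * a ^ y) (b ^ y)) :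
    |Real.log M| ≤ (b + |Real.log a| + |Real.log b|) * (y + 1) := by
  have hM0 : 0 < M := lt_of_lt_of_le (by positivity) hM.1
  have h1 := Real.log_le_log (by positivity) hM.1
  have h2 := Real.log_le_log hM0 hM.2
  rw [Real.log_mul (Real.exp_pos _).ne' (by positivity), Real.log_exp, Real.log_pow] at h1
  rw [Real.log_pow] at h2
  have hy : (0 : ℝ) ≤ y := Nat.cast_nonneg y
  have h3 := mul_le_mul_of_nonneg_left (neg_abs_le (Real.log a)) hy
  have h4 := mul_le_mul_of_nonneg_left (le_abs_self (Real.log b)) hy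
  have h5 := mul_nonneg hb.le hy
  have h6 := mul_nonneg (abs_nonneg (Real.log a)) hy
  have h7 := mul_nonneg (abs_nonneg (Real.log b)) hy
  rw [abs_le]
  constructor <;> nlinarith [abs_nonneg (Real.log a), abs_nonneg (Real.log b)]

/-- The growth rate of the logarithms of the output moments. -/
theorem exists_logBound (hp : PoissonParams g d s) (hA : 0 ≤ A) :
    ∃ K : ℝ, 0 < K ∧ ∀ (F : Measure ℝ) [IsProbabilityMeasure F], (∀ᵐ x ∂F, x ∈ Icc 0 A) →
      ∀ y, |Real.log (outputMoment g d s F y)| ≤ K * 2 ^ y := by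
  have := hp.gain_pos
  have := hp.dark_pos
  have := hp.slot_pos
  have hb : 0 < (g * A + d) * s := by positivity
  refine ⟨(g * A + d) * s + |Real.log (d * s)| + |Real.log ((g * A + d) * s)|, by positivity,
    fun F _ hF y => ?_⟩
  refine (log_bound_of_mem (by positivity) hb (outputMoment_mem hp hF y)).trans ?_
  have := natCast_add_one_le_two_pow y
  gcongr

theorem integrable_bind_of_le_pow (hp : PoissonParams g d s)
    (hF : ∀ᵐ x ∂F, x ∈ Icc 0 A) {G : Type*} [NormedAddCommGroup G] {c : ℕ → G} {K B : ℝ}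
    (hB : 1 ≤ B) (hc : ∀ y, ‖c y‖ ≤ K * B ^ y) :
    Integrable c (F.bind (poissonChannel g d s)) := by
  have hK : 0 ≤ K := by simpa using (norm_nonneg _).trans (hc 0)
  rw [Measure.integrable_comp_iff AEStronglyMeasurable.of_discrete]
  refine ⟨.of_forall fun x => integrable_poissonMeasure_of_le_pow hc _, ?_⟩
  refine Integrable.of_bound (C := K * Real.exp ((B - 1) * ((g * A + d) * s))) ?_ ?_
  · exact (StronglyMeasurable.integral_kernel
      (StronglyMeasurable.of_discrete (f := fun y => ‖c y‖))).aestronglyMeasurable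
  · filter_upwards [hF] with x hx
    rw [Real.norm_eq_abs, abs_of_nonneg (integral_nonneg fun _ => norm_nonneg _)]
    refine (integral_norm_poissonMeasure_le hc _).trans ?_
    have h1 := (poissonRate_mem hp hx).2
    have h2 : 0 ≤ B - 1 := by linarith
    exact mul_le_mul_of_nonneg_left (Real.exp_le_exp.2 (mul_le_mul_of_nonneg_left h1 h2)) hK

theorem integrable_log_outputMoment (hp : PoissonParams g d s) (hF : ∀ᵐ x ∂F, x ∈ Icc 0 A)
    (hA : 0 ≤ A) {F' : Measure ℝ} [IsProbabilityMeasure F']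
    (hF' : ∀ᵐ x ∂F', x ∈ Icc 0 A) :
    Integrable (fun y => Real.log (outputMoment g d s F' y))
      (F.bind (poissonChannel g d s)) := by
  obtain ⟨K, -, hK⟩ := exists_logBound hp hA
  exact integrable_bind_of_le_pow hp hF one_le_two (hK F' hF')

theorem integrable_log_outputMoment_poisson (hp : PoissonParams g d s) (hA : 0 ≤ A)
    (hF : ∀ᵐ x ∂F, x ∈ Icc 0 A) (r : ℝ≥0) :
    Integrable (fun y => Real.log (outputMoment g d s F y)) (poissonMeasure r) := by
  obtain ⟨K, -, hK⟩ := exists_logBound hp hA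
  exact integrable_poissonMeasure_of_le_pow (hK F hF) r

end Bounds

/-- The mutual information density of the Poisson channel: the divergence of the output law given
the input `x` from the output law under the input law `F`. -/
noncomputable def infoDensity (g d s : ℝ) (F : Measure ℝ) (x : ℝ) : ℝ :=
  poissonRate g d s x * Real.log (poissonRate g d s x) - poissonRate g d s x -
    ∫ y, Real.log (outputMoment g d s F y) ∂(poissonChannel g d s x)

/-- The mean under the input law `G` of the mutual information density of `F`. -/
noncomputable def crossInfo (g d s : ℝ) (F G : Measure ℝ) : ℝ := ∫ x, infoDensity g d s F x ∂G

/-! ### Averaged information densities -/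

section Info

variable {F G : Measure ℝ} [IsProbabilityMeasure F] [IsProbabilityMeasure G]

theorem continuous_rate_mul_log :
    Continuous fun x => (poissonRate g d s x : ℝ) * Real.log (poissonRate g d s x) -
      poissonRate g d s x := by
  have hc := continuous_poissonRate (g := g) (d := d) (s := s)
  have h1 : Continuous fun x => (poissonRate g d s x : ℝ) := by fun_prop
  exact (Real.continuous_mul_log.comp h1).sub h1

theorem integrable_integral_log_outputMoment (hp : PoissonParams g d s) (hA : 0 ≤ A)
    (hF : ∀ᵐ x ∂F, x ∈ Icc 0 A) (hG : ∀ᵐ x ∂G, x ∈ Icc 0 A) :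
    Integrable (fun x => ∫ y, Real.log (outputMoment g d s F y) ∂(poissonChannel g d s x)) G := by
  have h := integrable_log_outputMoment hp hG hA hF
  have h2 := ((Measure.integrable_comp_iff h.1).1 h).2
  refine h2.mono (StronglyMeasurable.integral_kernel
    StronglyMeasurable.of_discrete).aestronglyMeasurable (.of_forall fun x => ?_)
  refine (norm_integral_le_integral_norm _).trans (le_abs_self _)

theorem integrable_infoDensity (hp : PoissonParams g d s) (hA : 0 ≤ A)
    (hF : ∀ᵐ x ∂F, x ∈ Icc 0 A) (hG : ∀ᵐ x ∂G, x ∈ Icc 0 A) : Integrable (infoDensity g d s F) G :=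
  (integrable_of_continuousOn hG continuous_rate_mul_log.continuousOn).sub
    (integrable_integral_log_outputMoment hp hA hF hG)

theorem crossInfo_eq (hp : PoissonParams g d s) (hA : 0 ≤ A)
    (hF : ∀ᵐ x ∂F, x ∈ Icc 0 A) (hG : ∀ᵐ x ∂G, x ∈ Icc 0 A) : crossInfo g d s F G =
    ∫ x, ((poissonRate g d s x : ℝ) * Real.log (poissonRate g d s x) - poissonRate g d s x) ∂G -
      ∫ y, Real.log (outputMoment g d s F y) ∂(G.bind (poissonChannel g d s)) := by
  rw [crossInfo, integral_bind_kernel (integrable_log_outputMoment hp hG hA hF),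
    ← integral_sub (integrable_of_continuousOn hG continuous_rate_mul_log.continuousOn)
      (integrable_integral_log_outputMoment hp hA hF hG)]
  rfl

theorem log_div_bind_eq {F G : Measure ℝ} (hF : ∀ y, 0 < outputMoment g d s F y)
    (hG : ∀ y, 0 < outputMoment g d s G y) (y : ℕ) :
    Real.log ((F.bind (poissonChannel g d s)).real {y} /
      (G.bind (poissonChannel g d s)).real {y}) =
      Real.log (outputMoment g d s F y) - Real.log (outputMoment g d s G y) := by
  rw [bind_real_singleton, bind_real_singleton,
    div_div_div_cancel_right₀ (by exact_mod_cast Nat.factorial_ne_zero y),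
    Real.log_div (hF y).ne' (hG y).ne']

theorem integrable_log_div_bind (hp : PoissonParams g d s) (hA : 0 ≤ A)
    (hF : ∀ᵐ x ∂F, x ∈ Icc 0 A) (hG : ∀ᵐ x ∂G, x ∈ Icc 0 A) :
    Integrable (fun y => Real.log ((G.bind (poissonChannel g d s)).real {y} /
      (F.bind (poissonChannel g d s)).real {y})) (G.bind (poissonChannel g d s)) := by
  simp_rw [log_div_bind_eq (outputMoment_pos hp hG) (outputMoment_pos hp hF)]
  exact (integrable_log_outputMoment hp hG hA hG).sub
    (integrable_log_outputMoment hp hG hA hF)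

/-- The term in the rate alone is the same for both densities under G; what is left is the mean
log-ratio of the output laws, where the factorials cancel. -/
theorem crossInfo_eq_add_discreteKL (hp : PoissonParams g d s) (hA : 0 ≤ A)
    (hF : ∀ᵐ x ∂F, x ∈ Icc 0 A) (hG : ∀ᵐ x ∂G, x ∈ Icc 0 A) :
    crossInfo g d s F G = crossInfo g d s G G +
    discreteKL (G.bind (poissonChannel g d s)) (F.bind (poissonChannel g d s)) := by
  rw [crossInfo_eq hp hA hF hG, crossInfo_eq hp hA hG hG, discreteKL]
  simp_rw [log_div_bind_eq (outputMoment_pos hp hG) (outputMoment_pos hp hF)]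
  rw [integral_sub (integrable_log_outputMoment hp hG hA hG)
    (integrable_log_outputMoment hp hG hA hF)]
  ring

end Info

end Channel

/-! ### Mutual information as the mean of its density -/

section MutualInfo

open scoped Nat

variable {g d s A : ℝ} {F G : Measure ℝ} [IsProbabilityMeasure F] [IsProbabilityMeasure G]

theorem measurable_kernel_singleton_div {α : Type*} [MeasurableSpace α] (κ : Kernel α ℕ)
    (ν : Measure ℕ) : Measurable fun p : α × ℕ => κ p.1 {p.2} / ν {p.2} := by
  refine measurable_from_prod_countable_left fun y => ?_
  have h : Measurable fun x => κ x {y} := κ.measurable_coe (by simp)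
  exact h.div_const (ν {y})

/-- Since the output law charges every point, each row of the kernel has an explicit density with
respect to it; this makes the log-likelihood ratio computable. -/
theorem compProd_eq_withDensity {α : Type*} [MeasurableSpace α] {F : Measure α}
    [IsProbabilityMeasure F] (κ : Kernel α ℕ) [IsMarkovKernel κ]
    (hpos : ∀ y, 0 < (F.bind κ).real {y}) :
    F.compProd κ = (F.prod (F.bind κ)).withDensity
      (fun p => κ p.1 {p.2} / (F.bind κ) {p.2}) := by
  have hmeas : Measurable (Function.uncurry fun (x : α) (y : ℕ) => κ x {y} / (F.bind κ) {y}) :=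
    measurable_kernel_singleton_div κ (F.bind κ)
  have hκ : κ = Kernel.withDensity (Kernel.const α (F.bind κ))
      (fun x y => κ x {y} / (F.bind κ) {y}) := by
    ext x : 1
    refine Measure.ext_of_singleton fun y => ?_
    rw [Kernel.withDensity_apply _ hmeas, Kernel.const_apply, withDensity_apply _ (by simp),
      lintegral_singleton, ENNReal.div_mul_cancel]
    · intro h
      have := hpos y
      simp [measureReal_def, h] at this
    · exact measure_ne_top _ _
  have : IsSFiniteKernel (Kernel.withDensity (Kernel.const α (F.bind κ))
      (fun x y => κ x {y} / (F.bind κ) {y})) := hκ ▸ inferInstance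
  rw [← Measure.compProd_const, ← Measure.compProd_withDensity hmeas, ← hκ]

/-- The log-likelihood ratio of the joint law and the product law of the Poisson channel. -/
theorem llr_compProd_poissonChannel (hp : PoissonParams g d s)
    (hF : ∀ᵐ x ∂F, x ∈ Icc 0 A) :
    llr (F.compProd (poissonChannel g d s)) (F.prod (F.bind (poissonChannel g d s)))
      =ᵐ[F.compProd (poissonChannel g d s)]
    fun p => p.2 * Real.log (poissonRate g d s p.1) - poissonRate g d s p.1 -
      Real.log (outputMoment g d s F p.2) := by
  have hw := compProd_eq_withDensity (F := F) (poissonChannel g d s)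
    (bind_real_singleton_pos hp hF)
  have hmeas := measurable_kernel_singleton_div (poissonChannel g d s)
    (F.bind (poissonChannel g d s))
  have hac : F.compProd (poissonChannel g d s) ≪ F.prod (F.bind (poissonChannel g d s)) :=
    hw ▸ withDensity_absolutelyContinuous _ _
  have hrn := hac.ae_le (Measure.rnDeriv_withDensity (F.prod (F.bind (poissonChannel g d s))) hmeas)
  rw [← hw] at hrn
  have hsupp : ∀ᵐ p ∂(F.compProd (poissonChannel g d s)), p.1 ∈ Icc 0 A :=
    Measure.ae_compProd_of_ae_fst _ measurableSet_Icc hF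
  filter_upwards [hrn, hsupp] with p h1 h2
  have hr : 0 < (poissonRate g d s p.1 : ℝ) :=
    (mul_pos hp.dark_pos hp.slot_pos).trans_le (poissonRate_mem hp h2).1
  have hM := outputMoment_pos hp hF p.2
  have hfac : (0 : ℝ) < p.2 ! := by exact_mod_cast Nat.factorial_pos _
  rw [llr, h1, ENNReal.toReal_div, ← measureReal_def, ← measureReal_def, bind_real_singleton,
    poissonChannel_apply, poissonMeasure_real_singleton, div_div_div_cancel_right₀ hfac.ne',
    Real.log_div (by positivity) hM.ne', Real.log_mul (by positivity) (by positivity),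
    Real.log_exp, Real.log_pow]
  ring

theorem integrable_llr_compProd_poissonChannel (hp : PoissonParams g d s) (hA : 0 ≤ A)
    (hF : ∀ᵐ x ∂F, x ∈ Icc 0 A) :
    Integrable (fun p : ℝ × ℕ => p.2 * Real.log (poissonRate g d s p.1) - poissonRate g d s p.1 -
      Real.log (outputMoment g d s F p.2)) (F.compProd (poissonChannel g d s)) := by
  obtain ⟨K, hK0, hK⟩ := exists_logBound hp hA
  have hab : 0 < d * s := mul_pos hp.dark_pos hp.slot_pos
  set a := d * s
  set b := (g * A + d) * s
  set L := |Real.log a| + |Real.log b| + |b| + K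
  have hL : Integrable (fun y : ℕ => L * 2 ^ y) (F.bind (poissonChannel g d s)) := by
    refine integrable_bind_of_le_pow hp hF (K := L) one_le_two fun y => ?_
    rw [Real.norm_eq_abs, abs_of_nonneg (by positivity)]
  have hsnd : (F.compProd (poissonChannel g d s)).map Prod.snd =
      F.bind (poissonChannel g d s) := Measure.snd_compProd _ _
  have hL2 : Integrable (fun p : ℝ × ℕ => L * 2 ^ p.2) (F.compProd (poissonChannel g d s)) :=
    Integrable.comp_measurable (f := Prod.snd) (g := fun y : ℕ => L * 2 ^ y)
      (by rw [hsnd]; exact hL) measurable_snd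
  have hc := continuous_poissonRate (g := g) (d := d) (s := s)
  refine hL2.mono' ?_ ?_
  · refine Measurable.aestronglyMeasurable (measurable_from_prod_countable_left fun y => ?_)
    have : Measurable fun x => (poissonRate g d s x : ℝ) := by fun_prop
    fun_prop
  · have hsupp : ∀ᵐ p ∂(F.compProd (poissonChannel g d s)), p.1 ∈ Icc 0 A :=
      Measure.ae_compProd_of_ae_fst _ measurableSet_Icc hF
    filter_upwards [hsupp] with p h
    obtain ⟨h1, h2⟩ := poissonRate_mem hp h
    set r : ℝ := (poissonRate g d s p.1 : ℝ)
    have hl1 := Real.log_le_log hab h1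
    have hl2 := Real.log_le_log (hab.trans_le h1) h2
    have hlog : |Real.log r| ≤ |Real.log a| + |Real.log b| := by
      rw [abs_le]
      constructor
      · linarith [neg_abs_le (Real.log a), abs_nonneg (Real.log b)]
      · linarith [le_abs_self (Real.log b), abs_nonneg (Real.log a)]
    have hM := hK F hF p.2
    have hr0 : 0 ≤ r := hab.le.trans h1
    have hrb : |r| ≤ |b| := abs_le_abs_of_nonneg hr0 h2
    have hy := natCast_add_one_le_two_pow p.2
    have hone : (1 : ℝ) ≤ 2 ^ p.2 := one_le_pow₀ one_le_two
    calc |p.2 * Real.log r - r - Real.log (outputMoment g d s F p.2)|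
        ≤ |p.2 * Real.log r| + |r| + |Real.log (outputMoment g d s F p.2)| :=
          (abs_sub _ _).trans (by gcongr; exact abs_sub _ _)
      _ ≤ 2 ^ p.2 * (|Real.log a| + |Real.log b|) + 2 ^ p.2 * |b| + K * 2 ^ p.2 := by
          rw [abs_mul, Nat.abs_cast]
          have : |b| ≤ 2 ^ p.2 * |b| := le_mul_of_one_le_left (abs_nonneg _) hone
          gcongr
          · linarith
          · linarith
      _ = L * 2 ^ p.2 := by ring

/-- The mutual information of the Poisson channel is finite, and it is the mean of its density. -/
theorem mutualInfo_poissonChannel (hp : PoissonParams g d s) (hA : 0 ≤ A)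
    (hF : ∀ᵐ x ∂F, x ∈ Icc 0 A) :
    mutualInfo F (poissonChannel g d s) ≠ ⊤ ∧
      (mutualInfo F (poissonChannel g d s)).toReal = crossInfo g d s F F := by
  have hac : F.compProd (poissonChannel g d s) ≪ F.prod (F.bind (poissonChannel g d s)) :=
    compProd_eq_withDensity (F := F) (poissonChannel g d s) (bind_real_singleton_pos hp hF) ▸
      withDensity_absolutelyContinuous _ _
  have hllr := llr_compProd_poissonChannel hp hF
  have hint := integrable_llr_compProd_poissonChannel hp hA hF
  refine ⟨InformationTheory.klDiv_ne_top hac (hint.congr hllr.symm), ?_⟩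
  rw [mutualInfo, InformationTheory.toReal_klDiv_of_measure_eq hac (by simp),
    integral_congr_ae hllr, Measure.integral_compProd hint, crossInfo]
  refine integral_congr_ae (.of_forall fun x => ?_)
  simp only [infoDensity, poissonChannel_apply]
  have hid : Integrable (fun y : ℕ => (y : ℝ) * Real.log (poissonRate g d s x))
      (poissonMeasure (poissonRate g d s x)) := by
    refine Integrable.mul_const (integrable_poissonMeasure_of_le_pow (K := 1) (B := 2)
      (fun y => ?_) _) _
    rw [Real.norm_eq_abs, Nat.abs_cast, one_mul]
    linarith [natCast_add_one_le_two_pow y]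
  have hid' : Integrable (fun y : ℕ => (y : ℝ) * Real.log (poissonRate g d s x) -
      poissonRate g d s x) (poissonMeasure (poissonRate g d s x)) :=
    hid.sub (integrable_const _)
  rw [integral_sub hid' (integrable_log_outputMoment_poisson hp hA hF _),
    integral_sub hid (integrable_const _), integral_mul_const, integral_id_poissonMeasure]
  simp

end MutualInfo

/-! ### Identifiability of the input law -/

section Identifiability

variable {g d s A : ℝ} {F G : Measure ℝ} [IsProbabilityMeasure F] [IsProbabilityMeasure G]

theorem integral_pow_poissonMeasure (r : ℝ≥0) (z : ℂ) :
    ∫ y, z ^ y ∂(poissonMeasure r) = Complex.exp ((z - 1) * r) := by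
  rw [integral_poissonMeasure]
  have h := (NormedSpace.expSeries_div_hasSum_exp (z * (r : ℂ))).mul_left (Complex.exp (-r))
  rw [← Complex.exp_eq_exp_ℂ, ← Complex.exp_add] at h
  have h2 : (z - 1) * (r : ℂ) = -r + z * r := by ring
  rw [h2, ← h.tsum_eq]
  refine tsum_congr fun n => ?_
  rw [mul_pow, Complex.real_smul]
  push_cast
  ring

/-- The output law of the Poisson channel determines the input law. -/
theorem eq_of_bind_poissonChannel_eq (hp : PoissonParams g d s)
    (hF : ∀ᵐ x ∂F, x ∈ Icc 0 A) (hG : ∀ᵐ x ∂G, x ∈ Icc 0 A)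
    (h : F.bind (poissonChannel g d s) = G.bind (poissonChannel g d s)) : F = G := by
  have hg := hp.gain_pos
  have hs := hp.slot_pos
  -- The Poisson generating function at z = 1 + it/(gs) is exp((z - 1)(gx + d)s) = exp(itx)
  -- exp(itd/g), so the output law yields the characteristic function of the input.
  have key : ∀ (H : Measure ℝ) [IsProbabilityMeasure H], (∀ᵐ x ∂H, x ∈ Icc 0 A) → ∀ t : ℝ,
      charFun H t = Complex.exp (-(t * d / g * Complex.I)) *
        ∫ y, (1 + t / (g * s) * Complex.I : ℂ) ^ y ∂(H.bind (poissonChannel g d s)) := by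
    intro H _ hH t
    set z : ℂ := 1 + t / (g * s) * Complex.I
    have hint : Integrable (fun y : ℕ => z ^ y) (H.bind (poissonChannel g d s)) := by
      refine integrable_bind_of_le_pow hp hH (K := 1) (B := max 1 ‖z‖) (le_max_left _ _)
        fun y => ?_
      rw [norm_pow, one_mul]
      gcongr
      exact le_max_right _ _
    rw [integral_bind_kernel hint, charFun_apply_real, ← integral_const_mul]
    refine integral_congr_ae ?_
    filter_upwards [hH] with x hx
    rw [poissonChannel_apply, integral_pow_poissonMeasure, ← Complex.exp_add]
    congr 1
    have hr : ((poissonRate g d s x : ℝ) : ℂ) = (g * x + d) * s := by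
      rw [coe_poissonRate hp hx.1]; push_cast; ring
    have hg' : (g : ℂ) ≠ 0 := by exact_mod_cast hg.ne'
    have hs' : (s : ℂ) ≠ 0 := by exact_mod_cast hs.ne'
    rw [hr]
    simp only [z]
    field_simp
    ring
  refine Measure.ext_of_charFun (funext fun t => ?_)
  rw [key F hF, key G hG, h]

end Identifiability

/-! ### Stochastic degradation and strict data processing -/

section Degraded

open unitInterval

variable {W : PoissonWiretap} {A : ℝ} {F G : Measure ℝ} [IsProbabilityMeasure F]
  [IsProbabilityMeasure G]

namespace PoissonWiretap.IsDegraded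

theorem gainB_pos (hW : W.IsDegraded) : 0 < W.gainB := hW.gainE_pos.trans_le hW.gain_le

theorem paramsB (hW : W.IsDegraded) : PoissonParams W.gainB W.darkB W.slot :=
  ⟨hW.gainB_pos, hW.darkB_pos, hW.slot_pos⟩

theorem paramsE (hW : W.IsDegraded) : PoissonParams W.gainE W.darkE W.slot :=
  ⟨hW.gainE_pos, hW.darkE_pos, hW.slot_pos⟩

end PoissonWiretap.IsDegraded

namespace PoissonWiretap

instance : IsMarkovKernel W.channelB := inferInstanceAs (IsMarkovKernel (poissonChannel _ _ _))

instance : IsMarkovKernel W.channelE := inferInstanceAs (IsMarkovKernel (poissonChannel _ _ _))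

/-- The probability with which a count of the legitimate receiver also reaches the eavesdropper. -/
noncomputable def thinning (W : PoissonWiretap) : ℝ := W.gainE / W.gainB

/-- The mean of the counts of the eavesdropper that do not come from the legitimate receiver. -/
noncomputable def excess (W : PoissonWiretap) : ℝ := (W.darkE - W.thinning * W.darkB) * W.slot

theorem IsDegraded.thinning_pos (hW : W.IsDegraded) : 0 < W.thinning :=
  div_pos hW.gainE_pos hW.gainB_pos

theorem IsDegraded.thinning_le_one (hW : W.IsDegraded) : W.thinning ≤ 1 :=
  (div_le_one hW.gainB_pos).2 hW.gain_le

theorem IsDegraded.excess_nonneg (hW : W.IsDegraded) : 0 ≤ W.excess := by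
  refine mul_nonneg (sub_nonneg.2 ?_) hW.slot_pos.le
  have h := hW.dark_le
  rw [div_le_div_iff₀ hW.gainB_pos hW.gainE_pos] at h
  rw [thinning, div_mul_eq_mul_div, div_le_iff₀ hW.gainB_pos]
  linarith

theorem IsDegraded.thinning_lt_one_or (hW : W.IsDegraded) : W.thinning < 1 ∨ 0 < W.excess := by
  rcases hW.strict with h | h
  · exact Or.inl ((div_lt_one hW.gainB_pos).2 h)
  · refine Or.inr (mul_pos (sub_pos.2 ?_) hW.slot_pos)
    rw [div_lt_div_iff₀ hW.gainB_pos hW.gainE_pos] at h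
    rw [thinning, div_mul_eq_mul_div, div_lt_iff₀ hW.gainB_pos]
    linarith

theorem IsDegraded.rateE_eq (hW : W.IsDegraded) (x : ℝ) :
    (W.gainE * x + W.darkE) * W.slot =
      W.thinning * ((W.gainB * x + W.darkB) * W.slot) + W.excess := by
  have := hW.gainB_pos
  rw [excess, thinning]
  field_simp
  ring

/-- The eavesdropper's channel is the legitimate receiver's channel followed by thinning and
independent noise. -/
theorem IsDegraded.exists_degrading (hW : W.IsDegraded) :
    ∃ V : Kernel ℕ ℕ, IsMarkovKernel V ∧
      (∀ y₁ y₂, ∃ z, 0 < (V y₁).real {z} ∧ 0 < (V y₂).real {z}) ∧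
      ∀ {A : ℝ} {F : Measure ℝ}, (∀ᵐ x ∂F, x ∈ Icc 0 A) →
        F.bind W.channelE = (F.bind W.channelB).bind V := by
  let θ : I := ⟨W.thinning, hW.thinning_pos.le, hW.thinning_le_one⟩
  refine ⟨thinningKernel θ W.excess.toNNReal, inferInstance,
    thinningKernel_overlap hW.thinning_pos ?_, fun {A F} hF => ?_⟩
  · exact hW.thinning_lt_one_or.imp id Real.toNNReal_pos.2
  · rw [Measure.comp_assoc]
    refine Measure.comp_congr ?_
    filter_upwards [hF] with x hx
    rw [Kernel.comp_apply, channelB, channelE, poissonChannel_apply, poissonChannel_apply,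
      poissonMeasure_bind_thinningKernel]
    congr 1
    refine NNReal.coe_injective ?_
    rw [NNReal.coe_add, NNReal.coe_mul, coe_poissonRate hW.paramsB hx.1,
      coe_poissonRate hW.paramsE hx.1, Real.coe_toNNReal _ hW.thinning_pos.le,
      Real.coe_toNNReal _ hW.excess_nonneg, hW.rateE_eq]

theorem IsDegraded.discreteKL_nonneg (hW : W.IsDegraded) (hA : 0 ≤ A)
    (hF : ∀ᵐ x ∂F, x ∈ Icc 0 A) (hG : ∀ᵐ x ∂G, x ∈ Icc 0 A) :
    0 ≤ discreteKL (F.bind W.channelE) (G.bind W.channelE) :=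
  _root_.discreteKL_nonneg (bind_real_singleton_pos hW.paramsE hF)
    (bind_real_singleton_pos hW.paramsE hG) (integrable_log_div_bind hW.paramsE hA hG hF)

theorem IsDegraded.discreteKL_le (hW : W.IsDegraded) (hA : 0 ≤ A)
    (hF : ∀ᵐ x ∂F, x ∈ Icc 0 A) (hG : ∀ᵐ x ∂G, x ∈ Icc 0 A) :
    discreteKL (F.bind W.channelE) (G.bind W.channelE) ≤
        discreteKL (F.bind W.channelB) (G.bind W.channelB) ∧
      (discreteKL (F.bind W.channelE) (G.bind W.channelE) =
        discreteKL (F.bind W.channelB) (G.bind W.channelB) → F = G) := by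
  obtain ⟨V, hV, hover, hdeg⟩ := hW.exists_degrading
  have hE := integrable_log_div_bind hW.paramsE hA hG hF
  have hpF := bind_real_singleton_pos hW.paramsE hF
  have hpG := bind_real_singleton_pos hW.paramsE hG
  change ∀ y, 0 < (F.bind W.channelE).real {y} at hpF
  change ∀ y, 0 < (G.bind W.channelE).real {y} at hpG
  change Integrable (fun y => Real.log ((F.bind W.channelE).real {y} /
    (G.bind W.channelE).real {y})) (F.bind W.channelE) at hE
  rw [hdeg hF] at hE hpF
  rw [hdeg hG] at hE hpG
  rw [hdeg hF, hdeg hG]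
  obtain ⟨h1, h2⟩ := discreteKL_bind_le (P := F.bind W.channelB) (Q := G.bind W.channelB) V hover
    (bind_real_singleton_pos hW.paramsB hF) (bind_real_singleton_pos hW.paramsB hG) hpF hpG
    (integrable_log_div_bind hW.paramsB hA hG hF) hE
  exact ⟨h1, fun h => eq_of_bind_poissonChannel_eq hW.paramsB hF hG (h2 h)⟩

end PoissonWiretap

end Degraded

/-! ### Weak compactness and continuity -/

section Topology

open Filter Topology
open scoped Nat

variable {g d s A E : ℝ}

/-- The probability measures carried by `[0, A]`. -/
def lawsOnIcc (A : ℝ) : Set (ProbabilityMeasure ℝ) :=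
  {F | ∀ᵐ x ∂(F : Measure ℝ), x ∈ Icc 0 A}

theorem mem_feasibleInputs_iff {F : ProbabilityMeasure ℝ} : F ∈ feasibleInputs A E ↔
    F ∈ lawsOnIcc A ∧ ∫ x, x ∂(F : Measure ℝ) ≤ E := by
  have h : (F : Measure ℝ) (Icc 0 A) = 1 ↔ F ∈ lawsOnIcc A := by
    rw [lawsOnIcc, mem_ofPred_eq, ← prob_compl_eq_zero_iff measurableSet_Icc]
    rfl
  rw [feasibleInputs, mem_ofPred_eq, h]
  refine and_congr_right fun hF => ?_
  rw [Measure.restrict_eq_self_of_ae_mem hF]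

theorem lawsOnIcc_eq_range : lawsOnIcc A =
    range (fun μ : ProbabilityMeasure (Icc (0 : ℝ) A) =>
      μ.map (f := Subtype.val) measurable_subtype_coe.aemeasurable) := by
  ext F
  constructor
  · intro hF
    have hF' : ∀ᵐ x ∂(F : Measure ℝ), x ∈ range (Subtype.val : Icc (0 : ℝ) A → ℝ) := by
      rw [Subtype.range_val]; exact hF
    have hmap : ((F : Measure ℝ).comap (Subtype.val : Icc (0 : ℝ) A → ℝ)).map Subtype.val =
        (F : Measure ℝ) := by
      rw [(MeasurableEmbedding.subtype_coe measurableSet_Icc).map_comap, Subtype.range_val]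
      exact Measure.restrict_eq_self_of_ae_mem hF
    have hprob : IsProbabilityMeasure
        ((F : Measure ℝ).comap (Subtype.val : Icc (0 : ℝ) A → ℝ)) := by
      constructor
      have := congrArg (fun μ : Measure ℝ => μ univ) hmap
      simpa [Measure.map_apply measurable_subtype_coe MeasurableSet.univ] using this
    exact ⟨⟨_, hprob⟩, Subtype.ext hmap⟩
  · rintro ⟨μ, rfl⟩
    change ∀ᵐ x ∂((μ : Measure (Icc (0 : ℝ) A)).map Subtype.val), x ∈ Icc 0 A
    refine (ae_map_iff measurable_subtype_coe.aemeasurable (p := fun x => x ∈ Icc 0 A)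
      measurableSet_Icc).2 ?_
    exact .of_forall fun x => x.2

theorem isCompact_lawsOnIcc : IsCompact (lawsOnIcc A) := by
  rw [lawsOnIcc_eq_range]
  exact isCompact_range (ProbabilityMeasure.continuous_map continuous_subtype_val)

theorem continuousOn_integral_lawsOnIcc (hA : 0 ≤ A) {u : ℝ → ℝ} (hu : Continuous u) :
    ContinuousOn (fun F : ProbabilityMeasure ℝ => ∫ x, u x ∂(F : Measure ℝ)) (lawsOnIcc A) := by
  -- Clamping the argument to [0, A] makes the test function bounded without changing integrals
  -- against these laws.
  let v : BoundedContinuousFunction ℝ ℝ :=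
    (BoundedContinuousFunction.mkOfCompact
      ⟨fun x : Icc (0 : ℝ) A => u x, by fun_prop⟩).compContinuous
      ⟨projIcc 0 A hA, continuous_projIcc⟩
  have hv := (ProbabilityMeasure.continuous_integral_boundedContinuousFunction v).continuousOn
    (s := lawsOnIcc A)
  refine hv.congr fun F hF => integral_congr_ae ?_
  filter_upwards [hF] with x hx
  change u x = u (projIcc 0 A hA x)
  rw [projIcc_of_mem hA hx]

theorem isCompact_feasibleInputs (hA : 0 ≤ A) : IsCompact (feasibleInputs A E) := by
  have h : feasibleInputs A E = lawsOnIcc A ∩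
      (fun F : ProbabilityMeasure ℝ => ∫ x, x ∂(F : Measure ℝ)) ⁻¹' Iic E := by
    ext F; exact mem_feasibleInputs_iff
  rw [h]
  exact isCompact_lawsOnIcc.of_isClosed_subset
    ((continuousOn_integral_lawsOnIcc hA continuous_id).preimage_isClosed_of_isClosed
      isCompact_lawsOnIcc.isClosed isClosed_Iic) inter_subset_left

theorem continuousOn_outputMoment (hA : 0 ≤ A) (y : ℕ) :
    ContinuousOn (fun F : ProbabilityMeasure ℝ => outputMoment g d s (F : Measure ℝ) y)
      (lawsOnIcc A) := by
  have hc := continuous_poissonRate (g := g) (d := d) (s := s)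
  simp_rw [outputMoment_eq_integral]
  exact continuousOn_integral_lawsOnIcc hA (by fun_prop)

/-- Each output moment is weakly continuous and positive, so it remains to sum over outputs: moments
of order bʸ and logarithms of order 2ʸ give the uniform majorant K (2b)ʸ / y!. -/
theorem continuousOn_crossInfo (hp : PoissonParams g d s) (hA : 0 ≤ A) :
    ContinuousOn (fun p : ProbabilityMeasure ℝ × ProbabilityMeasure ℝ =>
      crossInfo g d s (p.1 : Measure ℝ) (p.2 : Measure ℝ)) (lawsOnIcc A ×ˢ lawsOnIcc A) := by
  obtain ⟨K, hK0, hK⟩ := exists_logBound hp hA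
  set b := (g * A + d) * s
  have hform : EqOn (fun p : ProbabilityMeasure ℝ × ProbabilityMeasure ℝ =>
      crossInfo g d s (p.1 : Measure ℝ) (p.2 : Measure ℝ))
      (fun p => ∫ x, ((poissonRate g d s x : ℝ) * Real.log (poissonRate g d s x) -
        poissonRate g d s x) ∂(p.2 : Measure ℝ) -
        ∑' y : ℕ, outputMoment g d s (p.2 : Measure ℝ) y / y ! *
          Real.log (outputMoment g d s (p.1 : Measure ℝ) y)) (lawsOnIcc A ×ˢ lawsOnIcc A) := by
    rintro ⟨F, G⟩ ⟨hF, hG⟩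
    simp only
    rw [crossInfo_eq hp hA hF hG, integral_countable (integrable_log_outputMoment hp hG hA hF)]
    simp_rw [bind_real_singleton, smul_eq_mul]
  refine ContinuousOn.congr ?_ hform
  refine ContinuousOn.sub ((continuousOn_integral_lawsOnIcc hA continuous_rate_mul_log).comp
    continuousOn_snd fun p hp => hp.2) ?_
  have hsum : Summable fun y : ℕ => K * ((2 * b) ^ y / y !) :=
    (Real.summable_pow_div_factorial (2 * b)).mul_left K
  refine continuousOn_tsum (fun y => ?_) hsum ?_
  · refine ContinuousOn.mul (((continuousOn_outputMoment hA y).comp continuousOn_snd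
      fun p hp => hp.2).div_const _) ?_
    refine ContinuousOn.log ((continuousOn_outputMoment hA y).comp continuousOn_fst
      fun p hp => hp.1) fun p hm => (outputMoment_pos hp hm.1 y).ne'
  · rintro y ⟨F, G⟩ ⟨hF, hG⟩
    have h1 := (outputMoment_mem hp hG y).2
    have h0 := outputMoment_pos hp hG y
    have h2 := hK F hF y
    simp only
    rw [norm_mul, Real.norm_eq_abs, Real.norm_eq_abs, abs_of_nonneg (by positivity)]
    have h3 : outputMoment g d s (G : Measure ℝ) y / y ! ≤ b ^ y / y ! := by gcongr
    clear_value b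
    calc _ ≤ b ^ y / y ! * (K * 2 ^ y) :=
          mul_le_mul h3 h2 (abs_nonneg _) ((div_nonneg h0.le (by positivity)).trans h3)
      _ = _ := by rw [mul_pow]; ring

end Topology

/-! ### Mixtures of input laws -/

section Mixture

variable {g d s A E : ℝ}

/-- The mixture of two laws with weights `1 - t` and `t`. -/
noncomputable def mixture (F G : ProbabilityMeasure ℝ) (t : unitInterval) : ProbabilityMeasure ℝ :=
  ⟨ENNReal.ofReal (1 - t) • (F : Measure ℝ) + ENNReal.ofReal t • (G : Measure ℝ), ⟨by
    have := t.2.1; have := t.2.2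
    simp only [Measure.add_apply, Measure.smul_apply, measure_univ, smul_eq_mul, mul_one]
    rw [← ENNReal.ofReal_add (by linarith) (by linarith)]
    simp⟩⟩

theorem coe_mixture (F G : ProbabilityMeasure ℝ) (t : unitInterval) :
    (mixture F G t : Measure ℝ) =
      ENNReal.ofReal (1 - t) • (F : Measure ℝ) + ENNReal.ofReal t • (G : Measure ℝ) := rfl

theorem integral_mixture {F G : ProbabilityMeasure ℝ} {t : unitInterval} {u : ℝ → ℝ}
    (hF : Integrable u (F : Measure ℝ)) (hG : Integrable u (G : Measure ℝ)) :
    ∫ x, u x ∂(mixture F G t : Measure ℝ) =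
      (1 - t) * ∫ x, u x ∂(F : Measure ℝ) + t * ∫ x, u x ∂(G : Measure ℝ) := by
  have := t.2.1; have := t.2.2
  rw [coe_mixture, integral_add_measure (hF.smul_measure ENNReal.ofReal_ne_top)
    (hG.smul_measure ENNReal.ofReal_ne_top), integral_smul_measure, integral_smul_measure,
    ENNReal.toReal_ofReal (by linarith), ENNReal.toReal_ofReal (by linarith)]
  rfl

theorem mixture_mem_lawsOnIcc {F G : ProbabilityMeasure ℝ} (hF : F ∈ lawsOnIcc A)
    (hG : G ∈ lawsOnIcc A) (t : unitInterval) : mixture F G t ∈ lawsOnIcc A := by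
  rw [lawsOnIcc, mem_ofPred_eq, coe_mixture, ae_add_measure_iff]
  exact ⟨Measure.ae_smul_measure hF _, Measure.ae_smul_measure hG _⟩

theorem integrable_id_of_mem_lawsOnIcc {F : ProbabilityMeasure ℝ} (hF : F ∈ lawsOnIcc A) :
    Integrable (fun x => x) (F : Measure ℝ) :=
  integrable_of_continuousOn hF continuousOn_id

theorem mixture_mem_feasibleInputs {F G : ProbabilityMeasure ℝ} (hF : F ∈ feasibleInputs A E)
    (hG : G ∈ feasibleInputs A E) (t : unitInterval) : mixture F G t ∈ feasibleInputs A E := by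
  rw [mem_feasibleInputs_iff] at *
  refine ⟨mixture_mem_lawsOnIcc hF.1 hG.1 t, ?_⟩
  rw [integral_mixture (integrable_id_of_mem_lawsOnIcc hF.1) (integrable_id_of_mem_lawsOnIcc hG.1)]
  have := t.2.1; have := t.2.2
  nlinarith [mul_le_mul_of_nonneg_left hF.2 (sub_nonneg.2 t.2.2),
    mul_le_mul_of_nonneg_left hG.2 t.2.1]

theorem crossInfo_mixture (hp : PoissonParams g d s) (hA : 0 ≤ A) {F G H : ProbabilityMeasure ℝ}
    (hF : F ∈ lawsOnIcc A) (hG : G ∈ lawsOnIcc A) (hH : H ∈ lawsOnIcc A) (t : unitInterval) :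
    crossInfo g d s H (mixture F G t) =
      (1 - t) * crossInfo g d s H F + t * crossInfo g d s H G :=
  integral_mixture (integrable_infoDensity hp hA hH hF) (integrable_infoDensity hp hA hH hG)

theorem continuous_mixture (F G : ProbabilityMeasure ℝ) :
    Continuous (mixture F G) := by
  rw [ProbabilityMeasure.continuous_iff_forall_continuous_integral]
  intro f
  have h : ∀ t, ∫ x, f x ∂(mixture F G t : Measure ℝ) =
      (1 - t) * ∫ x, f x ∂(F : Measure ℝ) + t * ∫ x, f x ∂(G : Measure ℝ) := fun t =>
    integral_mixture (f.integrable _) (f.integrable _)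
  simp_rw [h]
  fun_prop

theorem mixture_zero (F G : ProbabilityMeasure ℝ) : mixture F G 0 = F :=
  ProbabilityMeasure.toMeasure_injective (by simp [coe_mixture])

end Mixture

/-! ### Analyticity and the zero set of the optimality equation -/

section Analytic

open Filter Topology
open scoped Nat

/-- The mean of `c` under the Poisson law of mean `t`, as an entire function of `t`. -/
noncomputable def poissonMean (c : ℕ → ℝ) (t : ℝ) : ℝ :=
  Real.exp (-t) * ∑' y : ℕ, c y / y ! * t ^ y

theorem integral_eq_poissonMean (c : ℕ → ℝ) (r : ℝ≥0) :
    ∫ y, c y ∂(poissonMeasure r) = poissonMean c r := by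
  rw [integral_poissonMeasure, poissonMean, ← tsum_mul_left]
  refine tsum_congr fun y => ?_
  rw [smul_eq_mul]; ring

theorem analyticAt_poissonMean {c : ℕ → ℝ} {K B : ℝ} (hc : ∀ y, |c y| ≤ K * B ^ y) (t : ℝ) :
    AnalyticAt ℝ (poissonMean c) t := by
  let p : FormalMultilinearSeries ℝ ℝ ℝ :=
    FormalMultilinearSeries.ofScalars ℝ (fun y : ℕ => c y / (y ! : ℝ))
  have hrad : p.radius = ⊤ := by
    refine FormalMultilinearSeries.radius_eq_top_of_summable_norm _ fun r => ?_
    refine Summable.of_nonneg_of_le (fun n => by positivity) (fun n => ?_)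
      ((Real.summable_pow_div_factorial (B * r)).mul_left K)
    rw [FormalMultilinearSeries.ofScalars_norm, norm_div, Real.norm_eq_abs, Real.norm_natCast]
    calc |c n| / n ! * (r : ℝ) ^ n ≤ (K * B ^ n) / n ! * (r : ℝ) ^ n := by gcongr; exact hc n
      _ = _ := by rw [mul_pow]; ring
  have hp := p.hasFPowerSeriesOnBall (by rw [hrad]; exact ENNReal.zero_lt_top)
  have han : AnalyticAt ℝ p.sum t := by
    refine hp.analyticAt_of_mem ?_
    rw [hrad]; simp
  have hsum : p.sum = fun t => ∑' y : ℕ, c y / y ! * t ^ y := by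
    funext t
    refine tsum_congr fun y => ?_
    rw [FormalMultilinearSeries.ofScalars_apply_eq, smul_eq_mul]
  rw [hsum] at han
  have hexp : AnalyticAt ℝ (fun t : ℝ => Real.exp (-t)) t := by fun_prop
  exact hexp.mul han

/-- Continuity would force H 0 = 0, and then the difference quotient from the right is κ log t,
which tends to -∞. -/
theorem not_differentiableAt_of_eq_mul_log {κ : ℝ} (hκ : 0 < κ) {H : ℝ → ℝ}
    (h : ∀ t, 0 < t → κ * (t * Real.log t) = H t) : ¬ DifferentiableAt ℝ H 0 := by
  intro hd
  have hev : (fun t => κ * (t * Real.log t)) =ᶠ[𝓝[>] 0] H :=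
    eventually_nhdsWithin_of_forall fun t ht => h t ht
  have hlim1 : Tendsto H (𝓝[>] 0) (𝓝 0) := by
    refine Tendsto.congr' hev ?_
    have := (Real.continuous_mul_log.const_mul κ).tendsto 0
    simp only [zero_mul, mul_zero] at this
    exact this.mono_left nhdsWithin_le_nhds
  have hH0 : H 0 = 0 := tendsto_nhds_unique
    (hd.continuousAt.tendsto.mono_left nhdsWithin_le_nhds) hlim1
  have hslope := (hasDerivAt_iff_tendsto_slope.1 hd.hasDerivAt).mono_left
    (nhdsWithin_mono (0 : ℝ) (fun t (ht : 0 < t) => ht.ne'))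
  have hbot : Tendsto (fun t => κ * Real.log t) (𝓝[>] 0) atBot :=
    Real.tendsto_log_nhdsGT_zero.const_mul_atBot hκ
  refine not_tendsto_nhds_of_tendsto_atBot hbot (deriv H 0) (hslope.congr' ?_)
  filter_upwards [self_mem_nhdsWithin] with t ht
  have ht0 : t ≠ 0 := ne_of_gt ht
  rw [slope_def_field, hH0, sub_zero, sub_zero, ← h t ht]
  field_simp

/-- The optimality condition of the degraded Poisson wiretap channel, as an analytic equation in
the mean `t` of the legitimate receiver's output, has finitely many solutions in a compact
interval. -/
theorem finite_setOf_density_eq_affine {cB cE : ℕ → ℝ} {KB KE BB BE : ℝ}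
    (hcB : ∀ y, |cB y| ≤ KB * BB ^ y) (hcE : ∀ y, |cE y| ≤ KE * BE ^ y) {θ e ν a b γ C : ℝ}
    (hθ : 0 < θ) (he : 0 ≤ e) (hst : θ < 1 ∨ 0 < e) (hν : ν ∈ Icc (0 : ℝ) 1)
    (ha : 0 < a) :
    {t ∈ Icc a b | (t * Real.log t - t - poissonMean cB t) -
      ν * ((θ * t + e) * Real.log (θ * t + e) - (θ * t + e) - poissonMean cE (θ * t + e)) =
      γ * t + C}.Finite := by
  set g : ℝ → ℝ := fun t => (t * Real.log t - t - poissonMean cB t) -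
      ν * ((θ * t + e) * Real.log (θ * t + e) - (θ * t + e) - poissonMean cE (θ * t + e)) -
      (γ * t + C) with hg
  by_contra hinf
  have hinf : {t ∈ Icc a b | (t * Real.log t - t - poissonMean cB t) -
      ν * ((θ * t + e) * Real.log (θ * t + e) - (θ * t + e) - poissonMean cE (θ * t + e)) =
      γ * t + C}.Infinite := hinf
  obtain ⟨t₀, ht₀, hacc⟩ := hinf.exists_accPt_of_subset_isCompact isCompact_Icc
    (sep_subset _ _)
  have hEan : ∀ t, AnalyticAt ℝ (fun t => poissonMean cE (θ * t + e)) t := fun t =>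
    (analyticAt_poissonMean hcE (θ * t + e)).comp (f := fun t => θ * t + e) (by fun_prop)
  have hBan := analyticAt_poissonMean hcB
  have hgan : AnalyticOnNhd ℝ g (Ioi 0) := by
    intro t ht
    have ht : 0 < t := ht
    have h1 : 0 < θ * t + e := by positivity
    have hl1 : AnalyticAt ℝ Real.log t := analyticAt_log ht
    have hl2 : AnalyticAt ℝ (fun t => Real.log (θ * t + e)) t :=
      (analyticAt_log h1).comp (f := fun t => θ * t + e) (by fun_prop)
    have := hBan t
    have := hEan t
    fun_prop
  have hfreq : ∃ᶠ t in 𝓝[≠] t₀, g t = 0 := by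
    refine (accPt_iff_frequently_nhdsNE.1 hacc).mono fun t ht => ?_
    simp only [hg]
    linarith [ht.2]
  -- As a > 0, the accumulation point lies in (0, ∞), and the identity theorem reaches all t > 0,
  -- including values below the physical range.
  have hzero := hgan.eqOn_zero_of_preconnected_of_frequently_eq_zero isPreconnected_Ioi
    (show t₀ ∈ Ioi 0 from ha.trans_le ht₀.1) hfreq
  have hBd := (hBan 0).differentiableAt
  have hEd := (hEan 0).differentiableAt
  -- If e = 0, both logarithms are singular at 0 and t log t keeps the coefficient 1 - νθ > 0. If e
  -- > 0, only the first is singular, with coefficient 1.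
  rcases he.eq_or_lt with rfl | he
  · have hθ1 : θ < 1 := hst.resolve_right (lt_irrefl _)
    have hκ : 0 < 1 - ν * θ := by nlinarith [hν.1, hν.2]
    refine not_differentiableAt_of_eq_mul_log hκ (H := fun t => t + poissonMean cB t +
      ν * (θ * t * Real.log θ - θ * t - poissonMean cE (θ * t + 0)) + (γ * t + C)) ?_
      (by fun_prop)
    intro t ht
    have hz := hzero (show t ∈ Ioi 0 from ht)
    simp only [hg, Pi.zero_apply, add_zero] at hz ⊢
    rw [Real.log_mul hθ.ne' ht.ne'] at hz
    linear_combination hz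
  · have hlog : DifferentiableAt ℝ (fun t => Real.log (θ * t + e)) 0 :=
      DifferentiableAt.log (by fun_prop) (by simpa using he.ne')
    refine not_differentiableAt_of_eq_mul_log one_pos (H := fun t => t + poissonMean cB t +
      ν * ((θ * t + e) * Real.log (θ * t + e) - (θ * t + e) - poissonMean cE (θ * t + e)) +
      (γ * t + C)) ?_ (by fun_prop)
    intro t ht
    have hz := hzero (show t ∈ Ioi 0 from ht)
    simp only [hg, Pi.zero_apply] at hz
    linear_combination hz

end Analytic

/-! ### A multiplier for the mean constraint -/

section Lagrange

/-- Lagrange multiplier for maximizing `∫ g dF` over laws on `[0, A]` of mean at most `E`, from the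
optimality among laws with at most two mass points. -/
theorem exists_multiplier {g : ℝ → ℝ} {A E V : ℝ} (hA : 0 ≤ A) (hE : 0 < E)
    (h1 : ∀ x ∈ Icc 0 A, x ≤ E → g x ≤ V)
    (h2 : ∀ x ∈ Icc 0 A, ∀ y ∈ Icc 0 A, x < E → E < y →
      (y - E) / (y - x) * g x + (E - x) / (y - x) * g y ≤ V) :
    ∃ γ, 0 ≤ γ ∧ ∀ x ∈ Icc 0 A, g x ≤ V + γ * (x - E) := by
  -- Points x < E bound γ above by these slopes, points y > E bound it below, and `h2` says that
  -- every lower bound is at most every upper one. The infimum of the upper bounds works.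
  set T : Set ℝ := (fun x => (V - g x) / (E - x)) '' {x | x ∈ Icc 0 A ∧ x < E}
  have hne : T.Nonempty := ⟨_, 0, ⟨⟨le_rfl, hA⟩, hE⟩, rfl⟩
  have hnn : ∀ q ∈ T, 0 ≤ q := by
    rintro _ ⟨x, ⟨hx, hxE⟩, rfl⟩
    exact div_nonneg (sub_nonneg.2 (h1 x hx hxE.le)) (sub_nonneg.2 hxE.le)
  have hbdd : BddBelow T := ⟨0, hnn⟩
  refine ⟨sInf T, Real.sInf_nonneg hnn, fun x hx => ?_⟩
  rcases lt_trichotomy x E with hxE | rfl | hxE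
  · have h := csInf_le hbdd ⟨x, ⟨hx, hxE⟩, rfl⟩
    simp only at h
    rw [le_div_iff₀ (sub_pos.2 hxE)] at h
    linarith
  · simpa using h1 x hx le_rfl
  · have h : (g x - V) / (x - E) ≤ sInf T := by
      refine le_csInf hne ?_
      rintro _ ⟨y, ⟨hy, hyE⟩, rfl⟩
      have h3 := h2 y hy x hx hyE hxE
      have hd : 0 < x - y := by linarith
      rw [div_mul_eq_mul_div, div_mul_eq_mul_div, ← add_div, div_le_iff₀ hd] at h3
      change (g x - V) / (x - E) ≤ (V - g y) / (E - y)
      rw [div_le_div_iff₀ (sub_pos.2 hxE) (sub_pos.2 hyE)]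
      linarith
    rw [div_le_iff₀ (sub_pos.2 hxE)] at h
    linarith

end Lagrange

/-! ### Point masses -/

section Dirac

open scoped Nat

variable {g d s A E : ℝ}

theorem diracProba_mem_lawsOnIcc {x : ℝ} (hx : x ∈ Icc 0 A) : diracProba x ∈ lawsOnIcc A := by
  change ∀ᵐ y ∂(Measure.dirac x), y ∈ Icc 0 A
  exact (ae_dirac_iff (p := fun y => y ∈ Icc 0 A) measurableSet_Icc).2 hx

theorem diracProba_mem_feasibleInputs {x : ℝ} (hx : x ∈ Icc 0 A) (hxE : x ≤ E) :
    diracProba x ∈ feasibleInputs A E := by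
  rw [mem_feasibleInputs_iff]
  refine ⟨diracProba_mem_lawsOnIcc hx, ?_⟩
  change ∫ y, y ∂(Measure.dirac x) ≤ E
  rwa [integral_dirac]

theorem crossInfo_diracProba (F : Measure ℝ) (x : ℝ) :
    crossInfo g d s F (diracProba x : ProbabilityMeasure ℝ) = infoDensity g d s F x := by
  change ∫ y, infoDensity g d s F y ∂(Measure.dirac x) = _
  rw [integral_dirac]

theorem infoDensity_diracProba_self (hp : PoissonParams g d s) {x : ℝ} (hx : 0 ≤ x) :
    infoDensity g d s (diracProba x : ProbabilityMeasure ℝ) x = 0 := by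
  have hr : 0 < (poissonRate g d s x : ℝ) :=
    (mul_pos hp.dark_pos hp.slot_pos).trans_le (poissonRate_mem hp ⟨hx, le_refl x⟩).1
  have hM : ∀ y : ℕ, Real.log (outputMoment g d s (diracProba x : ProbabilityMeasure ℝ) y) =
      y * Real.log (poissonRate g d s x) - poissonRate g d s x := by
    intro y
    rw [outputMoment_eq_integral]
    change Real.log (∫ z, Real.exp (-(poissonRate g d s z : ℝ)) *
      (poissonRate g d s z : ℝ) ^ y ∂(Measure.dirac x)) = _
    rw [integral_dirac, Real.log_mul (Real.exp_pos _).ne' (by positivity), Real.log_exp,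
      Real.log_pow]
    ring
  have hid : Integrable (fun y : ℕ => (y : ℝ)) (poissonMeasure (poissonRate g d s x)) := by
    refine integrable_poissonMeasure_of_le_pow (K := 1) (B := 2) (fun y => ?_) _
    rw [Real.norm_eq_abs, Nat.abs_cast, one_mul]
    linarith [natCast_add_one_le_two_pow y]
  rw [infoDensity, poissonChannel_apply]
  simp_rw [hM]
  rw [integral_sub (hid.mul_const _) (integrable_const _), integral_mul_const,
    integral_id_poissonMeasure]
  simp

end Dirac

/-! ### Concavity, optimality conditions and discreteness -/

namespace PoissonWiretap

open Filter Topology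

variable {W : PoissonWiretap} {A E ν μ : ℝ} {F G H : ProbabilityMeasure ℝ}

/-- The difference of mutual informations `I(X;Y) - ν I(X;Z)`, with the information densities of the
input law `F` averaged over the input law `G`. -/
noncomputable def crossGain (W : PoissonWiretap) (ν : ℝ) (F G : ProbabilityMeasure ℝ) : ℝ :=
  crossInfo W.gainB W.darkB W.slot F G - ν * crossInfo W.gainE W.darkE W.slot F G

theorem IsDegraded.infoB_eq (hW : W.IsDegraded) (hA : 0 ≤ A) (hF : F ∈ lawsOnIcc A) :
    W.infoB F = 1 / W.slot * W.crossGain 0 F F := by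
  rw [infoB, channelB, (mutualInfo_poissonChannel hW.paramsB hA hF).2, crossGain]
  ring

theorem IsDegraded.infoE_eq (hW : W.IsDegraded) (hA : 0 ≤ A) (hF : F ∈ lawsOnIcc A) :
    W.infoE F = 1 / W.slot * crossInfo W.gainE W.darkE W.slot F F := by
  rw [infoE, channelE, (mutualInfo_poissonChannel hW.paramsE hA hF).2]

theorem IsDegraded.infoB_sub_infoE_eq (hW : W.IsDegraded) (hA : 0 ≤ A) (hF : F ∈ lawsOnIcc A) :
    W.infoB F - W.infoE F = 1 / W.slot * W.crossGain 1 F F := by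
  rw [hW.infoB_eq hA hF, hW.infoE_eq hA hF, crossGain, crossGain]
  ring

theorem IsDegraded.objective_eq (hW : W.IsDegraded) (hA : 0 ≤ A) (hF : F ∈ lawsOnIcc A) :
    W.objective μ F = 1 / W.slot * W.crossGain (1 - μ) F F := by
  rw [objective, hW.infoB_sub_infoE_eq hA hF, hW.infoB_eq hA hF]
  simp only [crossGain]
  ring

/-- The gap is D_B - ν D_E ≥ D_B - D_E because D_E ≥ 0 and ν ≤ 1; the last difference is positive
when F ≠ G, so strictness survives at ν = 1. -/
theorem IsDegraded.crossGain_le (hW : W.IsDegraded) (hA : 0 ≤ A) (hν : ν ∈ Icc (0 : ℝ) 1)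
    (hF : F ∈ lawsOnIcc A) (hG : G ∈ lawsOnIcc A) :
    W.crossGain ν G G ≤ W.crossGain ν F G ∧
      (F ≠ G → W.crossGain ν G G < W.crossGain ν F G) := by
  have hB := crossInfo_eq_add_discreteKL hW.paramsB hA hF hG
  have hE := crossInfo_eq_add_discreteKL hW.paramsE hA hF hG
  have h0 := hW.discreteKL_nonneg hA hG hF
  obtain ⟨h1, h2⟩ := hW.discreteKL_le hA hG hF
  unfold channelB at h1 h2
  unfold channelE at h0 h1 h2
  rw [crossGain, crossGain, hB, hE]
  constructor
  · nlinarith [hν.1, hν.2]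
  · intro hne
    have h3 := lt_of_le_of_ne h1 fun h =>
      hne (ProbabilityMeasure.toMeasure_injective (h2 h)).symm
    nlinarith [hν.1, hν.2]

theorem IsDegraded.crossGain_mixture (hW : W.IsDegraded) (hA : 0 ≤ A)
    (hF : F ∈ lawsOnIcc A) (hG : G ∈ lawsOnIcc A) (hH : H ∈ lawsOnIcc A) (t : unitInterval) :
    W.crossGain ν H (mixture F G t) =
      (1 - t) * W.crossGain ν H F + t * W.crossGain ν H G := by
  rw [crossGain, crossInfo_mixture hW.paramsB hA hF hG hH,
    crossInfo_mixture hW.paramsE hA hF hG hH, crossGain, crossGain]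
  ring

theorem IsDegraded.crossGain_concave (hW : W.IsDegraded) (hA : 0 ≤ A) (hν : ν ∈ Icc (0 : ℝ) 1)
    (hF : F ∈ lawsOnIcc A) (hG : G ∈ lawsOnIcc A) (t : unitInterval) :
    (1 - t) * W.crossGain ν F F + t * W.crossGain ν G G ≤
      W.crossGain ν (mixture F G t) (mixture F G t) := by
  have hM := mixture_mem_lawsOnIcc hF hG t
  rw [hW.crossGain_mixture hA hF hG hM]
  have h1 := (hW.crossGain_le hA hν hM hF).1
  have h2 := (hW.crossGain_le hA hν hM hG).1
  have := t.2.1; have := sub_nonneg.2 t.2.2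
  gcongr

theorem IsDegraded.continuousOn_crossGain (hW : W.IsDegraded) (hA : 0 ≤ A) (ν : ℝ) :
    ContinuousOn (fun p : ProbabilityMeasure ℝ × ProbabilityMeasure ℝ => W.crossGain ν p.1 p.2)
      (lawsOnIcc A ×ˢ lawsOnIcc A) :=
  (continuousOn_crossInfo hW.paramsB hA).sub
    ((continuousOn_crossInfo hW.paramsE hA).const_mul ν)

theorem IsDegraded.continuousOn_crossGain_self (hW : W.IsDegraded) (hA : 0 ≤ A) (ν : ℝ) :
    ContinuousOn (fun F : ProbabilityMeasure ℝ => W.crossGain ν F F) (lawsOnIcc A) :=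
  (hW.continuousOn_crossGain hA ν).comp (f := fun F => (F, F)) (by fun_prop) fun _ hF => ⟨hF, hF⟩

theorem feasibleInputs_subset : feasibleInputs A E ⊆ lawsOnIcc A := fun _ hF =>
  (mem_feasibleInputs_iff.1 hF).1

/-- A constant input carries no information, so `crossGain_le` against the point mass at x makes the
density difference nonnegative at each x. -/
theorem IsDegraded.crossGain_one_nonneg (hW : W.IsDegraded) (hA : 0 ≤ A)
    (hF : F ∈ lawsOnIcc A) : 0 ≤ W.crossGain 1 F F := by
  rw [crossGain, one_mul, crossInfo, crossInfo, ← integral_sub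
    (integrable_infoDensity hW.paramsB hA hF hF) (integrable_infoDensity hW.paramsE hA hF hF)]
  refine integral_nonneg_of_ae ?_
  filter_upwards [hF] with x hx
  have h := (hW.crossGain_le hA (ν := 1) (by simp) hF (diracProba_mem_lawsOnIcc hx)).1
  simp only [crossGain, crossInfo_diracProba, infoDensity_diracProba_self hW.paramsB hx.1,
    infoDensity_diracProba_self hW.paramsE hx.1] at h
  simp only [Pi.zero_apply]
  linarith

theorem infoB_nonneg (hW : W.IsDegraded) : 0 ≤ W.infoB F :=
  mul_nonneg (one_div_nonneg.2 hW.slot_pos.le) ENNReal.toReal_nonneg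

theorem IsDegraded.secrecy_nonneg (hW : W.IsDegraded) (hA : 0 ≤ A) (hF : F ∈ lawsOnIcc A) :
    0 ≤ W.infoB F - W.infoE F := by
  rw [hW.infoB_sub_infoE_eq hA hF]
  exact mul_nonneg (one_div_nonneg.2 hW.slot_pos.le) (hW.crossGain_one_nonneg hA hF)

theorem IsDegraded.isMaxOn_objective_iff (hW : W.IsDegraded) (hA : 0 ≤ A)
    (hF : F ∈ feasibleInputs A E) : IsMaxOn (W.objective μ) (feasibleInputs A E) F ↔
      ∀ G ∈ feasibleInputs A E, W.crossGain (1 - μ) G G ≤ W.crossGain (1 - μ) F F := by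
  refine forall₂_congr fun G hG => ?_
  rw [mem_ofPred_eq, hW.objective_eq hA (feasibleInputs_subset hG),
    hW.objective_eq hA (feasibleInputs_subset hF)]
  exact mul_le_mul_iff_right₀ (one_div_pos.2 hW.slot_pos)

theorem IsDegraded.exists_isMaxOn (hW : W.IsDegraded) (hA : 0 ≤ A) (hE : 0 ≤ E) (μ : ℝ) :
    ∃ F ∈ feasibleInputs A E, IsMaxOn (W.objective μ) (feasibleInputs A E) F := by
  obtain ⟨F, hF, hmax⟩ := (isCompact_feasibleInputs (E := E) hA).exists_isMaxOn
    ⟨_, diracProba_mem_feasibleInputs ⟨le_refl 0, hA⟩ hE⟩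
    ((hW.continuousOn_crossGain_self hA (1 - μ)).mono feasibleInputs_subset)
  exact ⟨F, hF, (hW.isMaxOn_objective_iff hA hF).2 hmax⟩

/-- The value at the midpoint M is the average of `crossGain` from M to F and to G; if M differed
from F or G, this average would exceed the maximum. -/
theorem IsDegraded.eq_of_isMaxOn (hW : W.IsDegraded) (hA : 0 ≤ A) (hμ : μ ∈ Icc (0 : ℝ) 1)
    (hF : F ∈ feasibleInputs A E) (hG : G ∈ feasibleInputs A E)
    (hFm : IsMaxOn (W.objective μ) (feasibleInputs A E) F)
    (hGm : IsMaxOn (W.objective μ) (feasibleInputs A E) G) : G = F := by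
  rw [hW.isMaxOn_objective_iff hA hF] at hFm
  rw [hW.isMaxOn_objective_iff hA hG] at hGm
  have hν : 1 - μ ∈ Icc (0 : ℝ) 1 := ⟨by linarith [hμ.2], by linarith [hμ.1]⟩
  have hF' := feasibleInputs_subset hF
  have hG' := feasibleInputs_subset hG
  let t : unitInterval := ⟨1 / 2, by norm_num, by norm_num⟩
  set M := mixture F G t
  have hM := mixture_mem_lawsOnIcc hF' hG' t
  have h1 := hW.crossGain_le hA hν hM hF'
  have h2 := hW.crossGain_le hA hν hM hG'
  have h3 := hFm M (mixture_mem_feasibleInputs hF hG t)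
  have h4 : W.crossGain (1 - μ) M M =
      (1 - 1 / 2) * W.crossGain (1 - μ) M F + 1 / 2 * W.crossGain (1 - μ) M G :=
    hW.crossGain_mixture hA hF' hG' hM t
  have h5 := hFm G hG
  have h6 := hGm F hF
  have hMF : M = F := by
    by_contra h
    linarith [h1.2 h, h2.1]
  have hMG : M = G := by
    by_contra h
    linarith [h2.2 h, h1.1]
  rw [← hMG, hMF]

/-- First-order optimality: an optimal law maximizes the mean of its own density. -/
theorem IsDegraded.crossGain_le_of_isMaxOn (hW : W.IsDegraded) (hA : 0 ≤ A)
    (hν : ν ∈ Icc (0 : ℝ) 1) (hF : F ∈ feasibleInputs A E)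
    (hmax : ∀ G ∈ feasibleInputs A E, W.crossGain ν G G ≤ W.crossGain ν F F)
    (hG : G ∈ feasibleInputs A E) : W.crossGain ν F G ≤ W.crossGain ν F F := by
  have hF' := feasibleInputs_subset hF
  have hG' := feasibleInputs_subset hG
  have hcont : Continuous fun t => W.crossGain ν (mixture F G t) G := by
    rw [← continuousOn_univ]
    exact (hW.continuousOn_crossGain hA ν).comp (f := fun t => (mixture F G t, G))
      ((continuous_mixture F G).prodMk continuous_const).continuousOn
      fun t _ => ⟨mixture_mem_lawsOnIcc hF' hG' t, hG'⟩
  -- The value at the mixture M is (1 - t) c(M, F) + t c(M, G), at most the maximum V, while c(M, F)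
  -- ≥ V. Hence c(M, G) ≤ V, and t → 0 replaces M by F.
  have hle : ∀ t : unitInterval, 0 < (t : ℝ) →
      W.crossGain ν (mixture F G t) G ≤ W.crossGain ν F F := by
    intro t ht
    have hM := mixture_mem_lawsOnIcc hF' hG' t
    have h1 := hmax _ (mixture_mem_feasibleInputs hF hG t)
    rw [hW.crossGain_mixture hA hF' hG' hM] at h1
    have h2 := mul_le_mul_of_nonneg_left (hW.crossGain_le hA hν hM hF').1
      (sub_nonneg.2 t.2.2)
    refine le_of_mul_le_mul_left ?_ ht
    linarith
  let u : ℕ → unitInterval := fun n => ⟨1 / ((n : ℝ) + 1), by positivity, by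
    rw [div_le_one (by positivity)]; linarith [Nat.cast_nonneg (α := ℝ) n]⟩
  have hu : Tendsto u atTop (𝓝 0) :=
    tendsto_subtype_rng.2 tendsto_one_div_add_atTop_nhds_zero_nat
  have hlim := (hcont.tendsto 0).comp hu
  rw [mixture_zero] at hlim
  exact le_of_tendsto' hlim fun n => hle (u n) (show (0 : ℝ) < 1 / ((n : ℝ) + 1) by positivity)

theorem IsDegraded.finite_setOf_density_eq (hW : W.IsDegraded) (hA : 0 ≤ A)
    (hν : ν ∈ Icc (0 : ℝ) 1) (hF : F ∈ lawsOnIcc A) (γ C : ℝ) :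
    {x ∈ Icc 0 A | infoDensity W.gainB W.darkB W.slot F x -
      ν * infoDensity W.gainE W.darkE W.slot F x = γ * x + C}.Finite := by
  obtain ⟨KB, -, hKB⟩ := exists_logBound hW.paramsB hA
  obtain ⟨KE, -, hKE⟩ := exists_logBound hW.paramsE hA
  have hg := hW.gainB_pos
  have hs := hW.slot_pos
  -- The constants rewrite γ x + C in the variable t = (gainB x + darkB) slot.
  have hfin := finite_setOf_density_eq_affine (hKB F hF) (hKE F hF) (ν := ν)
    (a := W.darkB * W.slot) (b := (W.gainB * A + W.darkB) * W.slot)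
    (γ := γ / (W.gainB * W.slot)) (C := C - γ * W.darkB / W.gainB) hW.thinning_pos
    hW.excess_nonneg hW.thinning_lt_one_or hν (mul_pos hW.darkB_pos hW.slot_pos)
  refine Set.Finite.subset (hfin.preimage (f := fun x => (W.gainB * x + W.darkB) * W.slot) ?_) ?_
  · intro x _ y _ hxy
    have := mul_right_cancel₀ hs.ne' hxy
    exact mul_left_cancel₀ hg.ne' (add_right_cancel this)
  · rintro x ⟨hx, heq⟩
    have hrB := coe_poissonRate hW.paramsB hx.1
    have hrE := coe_poissonRate hW.paramsE hx.1
    refine ⟨by simpa only [hrB] using poissonRate_mem hW.paramsB hx, ?_⟩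
    simp only [infoDensity, poissonChannel_apply, integral_eq_poissonMean, hrB, hrE,
      hW.rateE_eq] at heq
    rw [heq]
    field_simp
    ring

theorem IsDegraded.isFinitelyDiscrete_of_isMaxOn (hW : W.IsDegraded) (hA : 0 ≤ A) (hE : 0 < E)
    (hμ : μ ∈ Icc (0 : ℝ) 1) (hF : F ∈ feasibleInputs A E)
    (hFm : IsMaxOn (W.objective μ) (feasibleInputs A E) F) : IsFinitelyDiscrete F := by
  rw [hW.isMaxOn_objective_iff hA hF] at hFm
  have hν : 1 - μ ∈ Icc (0 : ℝ) 1 := ⟨by linarith [hμ.2], by linarith [hμ.1]⟩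
  generalize 1 - μ = ν at hFm hν
  have hF' := feasibleInputs_subset hF
  set V := W.crossGain ν F F with hV
  set g : ℝ → ℝ := fun x => infoDensity W.gainB W.darkB W.slot F x -
      ν * infoDensity W.gainE W.darkE W.slot F x with hg
  have hfo := fun G hG => hW.crossGain_le_of_isMaxOn hA hν hF hFm (G := G) hG
  have hdirac : ∀ x, W.crossGain ν F (diracProba x) = g x := fun x => by
    simp only [crossGain, crossInfo_diracProba, hg]
  obtain ⟨γ, hγ, hle⟩ := exists_multiplier (g := g) (V := V) hA hE
    (fun x hx hxE => by
      rw [← hdirac]; exact hfo _ (diracProba_mem_feasibleInputs hx hxE))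
    (fun x hx y hy hxE hyE => by
      have hd : 0 < y - x := by linarith
      -- This weight gives the two-point law mean exactly E.
      let t : unitInterval := ⟨(E - x) / (y - x), div_nonneg (by linarith) hd.le,
        (div_le_one hd).2 (by linarith)⟩
      have hxl := diracProba_mem_lawsOnIcc hx
      have hyl := diracProba_mem_lawsOnIcc hy
      have h1t : 1 - (E - x) / (y - x) = (y - E) / (y - x) := by field_simp; ring
      have hmem : mixture (diracProba x) (diracProba y) t ∈ feasibleInputs A E := by
        rw [mem_feasibleInputs_iff]
        refine ⟨mixture_mem_lawsOnIcc hxl hyl t, ?_⟩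
        rw [integral_mixture (integrable_id_of_mem_lawsOnIcc hxl)
          (integrable_id_of_mem_lawsOnIcc hyl)]
        change (1 - (E - x) / (y - x)) * ∫ z, z ∂(Measure.dirac x) +
          (E - x) / (y - x) * ∫ z, z ∂(Measure.dirac y) ≤ E
        rw [integral_dirac, integral_dirac]
        refine le_of_eq ?_
        field_simp
        ring
      have h := hfo _ hmem
      rw [hW.crossGain_mixture hA hxl hyl hF', hdirac, hdirac] at h
      change (1 - (E - x) / (y - x)) * g x + (E - x) / (y - x) * g y ≤ V at h
      rwa [h1t] at h)
  have hBi := integrable_infoDensity hW.paramsB hA hF' hF'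
  have hEi := (integrable_infoDensity hW.paramsE hA hF' hF').const_mul ν
  have hgi : Integrable g (F : Measure ℝ) := hBi.sub hEi
  have hgV : ∫ x, g x ∂(F : Measure ℝ) = V := by
    rw [hV, crossGain, crossInfo, crossInfo, ← integral_const_mul, ← integral_sub hBi hEi]
  have hxi := integrable_id_of_mem_lawsOnIcc hF'
  have hli : Integrable (fun x => V + γ * (x - E)) (F : Measure ℝ) :=
    (integrable_const V).add ((hxi.sub (integrable_const E)).const_mul γ)
  have h0 : 0 ≤ᵐ[(F : Measure ℝ)] fun x => V + γ * (x - E) - g x := by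
    filter_upwards [hF'] with x hx
    exact sub_nonneg.2 (hle x hx)
  -- The density averages to V and γ (mean - E) ≤ 0, so this nonnegative slack has zero integral: F
  -- is carried by the equality set.
  have hint : ∫ x, (V + γ * (x - E) - g x) ∂(F : Measure ℝ) = 0 := by
    refine le_antisymm ?_ (integral_nonneg_of_ae h0)
    have hxE : Integrable (fun x => x - E) (F : Measure ℝ) := hxi.sub (integrable_const E)
    rw [integral_sub hli hgi, hgV, integral_add (integrable_const V) (hxE.const_mul γ),
      integral_const_mul,
      integral_sub hxi (integrable_const E)]
    have := mul_nonneg hγ (sub_nonneg.2 (mem_feasibleInputs_iff.1 hF).2)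
    simp only [integral_const, probReal_univ, one_smul]
    linarith
  rw [integral_eq_zero_iff_of_nonneg_ae h0 (hli.sub hgi)] at hint
  have hfin := hW.finite_setOf_density_eq hA hν hF' γ (V - γ * E)
  refine ⟨hfin.toFinset, ?_⟩
  rw [Set.Finite.coe_toFinset]
  change ∀ᵐ x ∂(F : Measure ℝ), x ∈ {x ∈ Icc 0 A | g x = γ * x + (V - γ * E)}
  filter_upwards [hF', hint] with x hx hx0
  refine ⟨hx, ?_⟩
  simp only [Pi.zero_apply] at hx0
  linarith

/-! ### Geometry of the rate-equivocation region -/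

section Region

/-- From an interior point one could move along the diagonal and raise both coordinates. -/
theorem mem_boundary_of_mem_region {p : ℝ × ℝ} (hp : p ∈ W.region A E)
    (h : ∀ q ∈ W.region A E, ¬(p.1 < q.1 ∧ p.2 < q.2)) : p ∈ W.boundary A E := by
  refine ⟨⟨subset_closure hp, fun hint => ?_⟩, h⟩
  have hcont : Tendsto (fun t : ℝ => (p.1 + t, p.2 + t)) (𝓝[>] 0) (𝓝 p) := by
    have : Continuous fun t : ℝ => (p.1 + t, p.2 + t) := by fun_prop
    have h2 := this.tendsto 0
    simp only [add_zero] at h2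
    exact h2.mono_left nhdsWithin_le_nhds
  obtain ⟨t, ht, ht0⟩ := ((hcont.eventually (mem_interior_iff_mem_nhds.1 hint)).and
    self_mem_nhdsWithin).exists
  have ht0 : 0 < t := ht0
  exact h _ ht ⟨by simpa using ht0, by simpa using ht0⟩

theorem IsDegraded.info_mem_region (hW : W.IsDegraded) (hA : 0 ≤ A)
    (hF : F ∈ feasibleInputs A E) : (W.infoB F, W.infoB F - W.infoE F) ∈ W.region A E :=
  ⟨F, hF, ⟨infoB_nonneg hW, le_rfl⟩, hW.secrecy_nonneg hA (feasibleInputs_subset hF), le_rfl⟩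

theorem Achieves.le_objective {p : ℝ × ℝ} (h : W.Achieves F p) (hμ : μ ∈ Icc (0 : ℝ) 1) :
    μ * p.1 + (1 - μ) * p.2 ≤ W.objective μ F :=
  add_le_add (mul_le_mul_of_nonneg_left h.1.2 hμ.1)
    (mul_le_mul_of_nonneg_left h.2.2 (sub_nonneg.2 hμ.2))

theorem IsDegraded.info_mem_boundary (hW : W.IsDegraded) (hA : 0 ≤ A) (hμ : μ ∈ Icc (0 : ℝ) 1)
    (hF : F ∈ feasibleInputs A E) (hFm : IsMaxOn (W.objective μ) (feasibleInputs A E) F) :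
    (W.infoB F, W.infoB F - W.infoE F) ∈ W.boundary A E := by
  refine mem_boundary_of_mem_region (hW.info_mem_region hA hF) ?_
  rintro q ⟨G, hG, hq⟩ ⟨h1, h2⟩
  have h3 := hq.le_objective hμ
  have h4 : W.objective μ G ≤ W.objective μ F := hFm hG
  simp only at h1 h2
  unfold objective at h3 h4
  -- At μ = 0 the strict gain in the second coordinate is needed; otherwise the first suffices.
  rcases hμ.1.eq_or_lt with h | h
  · subst h
    linarith
  · have h5 := mul_lt_mul_of_pos_left h1 h
    have h6 := mul_le_mul_of_nonneg_left h2.le (sub_nonneg.2 hμ.2)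
    linarith

theorem IsDegraded.isCompact_region (hW : W.IsDegraded) (hA : 0 ≤ A) :
    IsCompact (W.region A E) := by
  have hscale : ∀ {q I : ℝ}, 0 ≤ q → q ≤ I → ∃ u ∈ Icc (0 : ℝ) 1, u * I = q := by
    intro q I h0 h1
    rcases (h0.trans h1).eq_or_lt with h | h
    · exact ⟨0, by simp, by linarith⟩
    · exact ⟨q / I, ⟨div_nonneg h0 h.le, (div_le_one h).2 h1⟩, div_mul_cancel₀ _ h.ne'⟩
  -- Scaling factors in [0, 1] parametrize the rectangle of pairs achieved by each law, so the
  -- region is a continuous image of a compact set.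
  have himage : W.region A E = (fun x : ProbabilityMeasure ℝ × (ℝ × ℝ) =>
      (x.2.1 * (1 / W.slot * W.crossGain 0 x.1 x.1), x.2.2 * (1 / W.slot * W.crossGain 1 x.1 x.1)))
      '' (feasibleInputs A E ×ˢ (Icc 0 1 ×ˢ Icc 0 1)) := by
    ext p
    constructor
    · rintro ⟨F, hF, ⟨h1, h2⟩, h3, h4⟩
      rw [hW.infoB_eq hA (feasibleInputs_subset hF)] at h2
      rw [hW.infoB_sub_infoE_eq hA (feasibleInputs_subset hF)] at h4
      obtain ⟨u, hu, hue⟩ := hscale h1 h2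
      obtain ⟨v, hv, hve⟩ := hscale h3 h4
      exact ⟨(F, u, v), ⟨hF, hu, hv⟩, Prod.ext hue hve⟩
    · rintro ⟨⟨F, u, v⟩, ⟨hF, hu, hv⟩, rfl⟩
      have hF' : F ∈ lawsOnIcc A := feasibleInputs_subset hF
      have h1 := infoB_nonneg hW (F := F)
      have h2 := hW.secrecy_nonneg hA hF'
      refine ⟨F, hF, ?_⟩
      simp only [Achieves, ← hW.infoB_eq hA hF', ← hW.infoB_sub_infoE_eq hA hF']
      exact ⟨⟨mul_nonneg hu.1 h1, mul_le_of_le_one_left h1 hu.2⟩,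
        mul_nonneg hv.1 h2, mul_le_of_le_one_left h2 hv.2⟩
  rw [himage]
  refine ((isCompact_feasibleInputs hA).prod (isCompact_Icc.prod isCompact_Icc))
    |>.image_of_continuousOn ?_
  have hc : ∀ ν, ContinuousOn (fun x : ProbabilityMeasure ℝ × (ℝ × ℝ) => W.crossGain ν x.1 x.1)
      (feasibleInputs A E ×ˢ (Icc 0 1 ×ˢ Icc 0 1)) := fun ν =>
    (hW.continuousOn_crossGain_self hA ν).comp continuousOn_fst
      fun x hx => feasibleInputs_subset hx.1
  exact (ContinuousOn.mul (by fun_prop) (continuousOn_const.mul (hc 0))).prodMk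
    (ContinuousOn.mul (by fun_prop) (continuousOn_const.mul (hc 1)))

theorem IsDegraded.convex_region (hW : W.IsDegraded) (hA : 0 ≤ A) :
    Convex ℝ (W.region A E) := by
  rintro p ⟨F, hF, ⟨hp1, hp2⟩, hp3, hp4⟩ q ⟨G, hG, ⟨hq1, hq2⟩, hq3, hq4⟩ a b ha hb hab
  let t : unitInterval := ⟨b, hb, by linarith⟩
  have hF' := feasibleInputs_subset hF
  have hG' := feasibleInputs_subset hG
  have hM := mixture_mem_lawsOnIcc hF' hG' t
  have hs := one_div_pos.2 hW.slot_pos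
  have ha' : a = 1 - b := by linarith
  have hc0 : (1 - b) * W.crossGain 0 F F + b * W.crossGain 0 G G ≤ _ :=
    hW.crossGain_concave hA (ν := 0) (by simp) hF' hG' t
  have hc1 : (1 - b) * W.crossGain 1 F F + b * W.crossGain 1 G G ≤ _ :=
    hW.crossGain_concave hA (ν := 1) (by simp) hF' hG' t
  have hd0 := mul_le_mul_of_nonneg_left hc0 hs.le
  have hd1 := mul_le_mul_of_nonneg_left hc1 hs.le
  refine ⟨mixture F G t, mixture_mem_feasibleInputs hF hG t, ?_⟩
  rw [Achieves, hW.infoB_sub_infoE_eq hA hM, hW.infoB_eq hA hM]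
  simp only [Prod.fst_add, Prod.snd_add, Prod.smul_fst, Prod.smul_snd, smul_eq_mul]
  rw [hW.infoB_eq hA hF'] at hp2
  rw [hW.infoB_eq hA hG'] at hq2
  rw [hW.infoB_sub_infoE_eq hA hF'] at hp4
  rw [hW.infoB_sub_infoE_eq hA hG'] at hq4
  have e1 := mul_le_mul_of_nonneg_left hp2 ha
  have e2 := mul_le_mul_of_nonneg_left hq2 hb
  have e3 := mul_le_mul_of_nonneg_left hp4 ha
  have e4 := mul_le_mul_of_nonneg_left hq4 hb
  subst ha'
  exact ⟨⟨by positivity, by linarith⟩, by positivity, by linarith⟩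

end Region

end PoissonWiretap

/-! ### Supporting lines at undominated points -/

section Supporting

/-- A point of a convex planar set that no other point strictly dominates in both coordinates
maximizes a convex combination of the coordinates. -/
theorem exists_weight_of_not_dominated {R : Set (ℝ × ℝ)} (hR : Convex ℝ R) {p : ℝ × ℝ} (hp : p ∈ R)
    (h : ∀ q ∈ R, ¬(p.1 < q.1 ∧ p.2 < q.2)) :
    ∃ μ ∈ Icc (0 : ℝ) 1, ∀ q ∈ R, μ * q.1 + (1 - μ) * q.2 ≤ μ * p.1 + (1 - μ) * p.2 := by
  have hopen : IsOpen (Ioi p.1 ×ˢ Ioi p.2) := isOpen_Ioi.prod isOpen_Ioi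
  have hconv : Convex ℝ (Ioi p.1 ×ˢ Ioi p.2) := (convex_Ioi _).prod (convex_Ioi _)
  have hdisj : Disjoint (Ioi p.1 ×ˢ Ioi p.2) R :=
    Set.disjoint_left.2 fun q hq hqR => h q hqR hq
  -- The functional is bounded above on the quadrant, so its coefficients are nonpositive; their sum
  -- is negative, and dividing by it gives the weights. As p is a corner of the quadrant, f p ≤ u,
  -- so p minimizes f on R.
  obtain ⟨f, u, hfu, hfR⟩ := geometric_hahn_banach_open hconv hopen hR hdisj
  set α := f (1, 0)
  set β := f (0, 1)
  have hf : ∀ q : ℝ × ℝ, f q = q.1 * α + q.2 * β := fun q => by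
    have : q = q.1 • ((1, 0) : ℝ × ℝ) + q.2 • ((0, 1) : ℝ × ℝ) := by ext <;> simp
    conv_lhs => rw [this]
    rw [map_add, map_smul, map_smul, smul_eq_mul, smul_eq_mul]
  have hup := hfR p hp
  rw [hf] at hup
  have hst : ∀ s t : ℝ, 0 < s → 0 < t → (p.1 + s) * α + (p.2 + t) * β < u := fun s t hs ht => by
    have := hfu (p.1 + s, p.2 + t) ⟨by simpa using hs, by simpa using ht⟩
    rwa [hf] at this
  have hα : α ≤ 0 := by
    by_contra! hα
    have := hst ((|β| + 1) / α) 1 (by positivity) one_pos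
    rw [add_mul, div_mul_cancel₀ _ hα.ne'] at this
    linarith [neg_abs_le β]
  have hβ : β ≤ 0 := by
    by_contra! hβ
    have := hst 1 ((|α| + 1) / β) one_pos (by positivity)
    rw [add_mul _ _ β, div_mul_cancel₀ _ hβ.ne'] at this
    linarith [neg_abs_le α]
  have hαβ : α + β < 0 := by linarith [hst 1 1 one_pos one_pos]
  have hpu : p.1 * α + p.2 * β ≤ u := by
    refine le_of_forall_pos_le_add fun ε hε => ?_
    have := hst (ε / -(α + β)) (ε / -(α + β)) (div_pos hε (by linarith))
      (div_pos hε (by linarith))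
    have h2 : ε / -(α + β) * (α + β) = -ε := by
      have := hαβ.ne
      rw [div_neg, neg_mul, div_mul_cancel₀ _ this]
    linarith
  have h1 : 1 - α / (α + β) = β / (α + β) := by
    have := hαβ.ne
    field_simp
    ring
  refine ⟨α / (α + β), ⟨div_nonneg_of_nonpos hα hαβ.le, (div_le_one_of_neg hαβ).2 (by linarith)⟩,
    fun q hq => ?_⟩
  have hq' := hfR q hq
  rw [hf] at hq'
  rw [h1, div_mul_eq_mul_div, div_mul_eq_mul_div, div_mul_eq_mul_div, div_mul_eq_mul_div,
    ← add_div, ← add_div]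
  exact div_le_div_of_nonpos_of_le hαβ.le (by linarith)

end Supporting

/-! ### The theorem -/

theorem theorem3 (W : PoissonWiretap) (hW : W.IsDegraded) (A E : ℝ) (hA : 0 < A) (hE : 0 < E) :
    -- all mutual informations involved are finite
    (∀ F ∈ feasibleInputs A E,
      mutualInfo (F : Measure ℝ) W.channelB ≠ ⊤ ∧ mutualInfo (F : Measure ℝ) W.channelE ≠ ⊤) ∧
    -- each weighted objective has a unique maximizer; it is discrete with finitely many mass
    -- points, and its rate-equivocation pair lies on the boundary
    (∀ μ ∈ Icc (0 : ℝ) 1, ∃ F ∈ feasibleInputs A E,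
      IsMaxOn (W.objective μ) (feasibleInputs A E) F ∧
      (∀ G ∈ feasibleInputs A E, IsMaxOn (W.objective μ) (feasibleInputs A E) G → G = F) ∧
      IsFinitelyDiscrete F ∧
      (W.infoB F, W.infoB F - W.infoE F) ∈ W.boundary A E) ∧
    -- each boundary point is achieved by a unique input law; that law is discrete with finitely
    -- many mass points and maximizes one of the weighted objectives
    (∀ p ∈ W.boundary A E, ∃ F ∈ feasibleInputs A E,
      W.Achieves F p ∧
      (∀ G ∈ feasibleInputs A E, W.Achieves G p → G = F) ∧
      IsFinitelyDiscrete F ∧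
      ∃ μ ∈ Icc (0 : ℝ) 1, IsMaxOn (W.objective μ) (feasibleInputs A E) F) := by
  refine ⟨fun F hF => ?_, fun μ hμ => ?_, fun p hp => ?_⟩
  · have hF' := PoissonWiretap.feasibleInputs_subset hF
    exact ⟨(mutualInfo_poissonChannel hW.paramsB hA.le hF').1,
      (mutualInfo_poissonChannel hW.paramsE hA.le hF').1⟩
  · obtain ⟨F, hF, hmax⟩ := hW.exists_isMaxOn hA.le hE.le μ
    exact ⟨F, hF, hmax, fun G hG hGm => hW.eq_of_isMaxOn hA.le hμ hF hG hmax hGm,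
      hW.isFinitelyDiscrete_of_isMaxOn hA.le hE hμ hF hmax,
      hW.info_mem_boundary hA.le hμ hF hmax⟩
  · have hpR : p ∈ W.region A E := by
      have := hp.1.1
      rwa [(hW.isCompact_region hA.le).isClosed.closure_eq] at this
    obtain ⟨μ, hμ, hsup⟩ := exists_weight_of_not_dominated (hW.convex_region hA.le) hpR hp.2
    -- The weighted value of p bounds every objective value from above, and the objective of any law
    -- achieving p is at least that value.
    have hmax : ∀ G ∈ feasibleInputs A E, W.Achieves G p →
        IsMaxOn (W.objective μ) (feasibleInputs A E) G := fun G _ hGp H hH =>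
      (hsup _ (hW.info_mem_region hA.le hH)).trans (hGp.le_objective hμ)
    obtain ⟨F, hF, hFp⟩ := hpR
    exact ⟨F, hF, hFp,
      fun G hG hGp => hW.eq_of_isMaxOn hA.le hμ hF hG (hmax F hF hFp) (hmax G hG hGp),
      hW.isFinitelyDiscrete_of_isMaxOn hA.le hE hμ hF (hmax F hF hFp), μ, hμ, hmax F hF hFp⟩
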